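/- Let $M$ be a bounded, connected, embedded (not necessarily closed) complex submanifold of $\mathbb{C}^d$, and let $\mathsf{k}_M$ be its Kobayashi distance, i.e. $\mathsf{k}_M(z,w)$ is the infimum of the sums of Poincaré distances $\sum_i \rho(a_i,b_i)$ over all finite chains of holomorphic maps $f_i$ from the unit disc into $M$ that lead from $z$ to $w$ (the first chain point $f_1(a_1)$ is $z$, the last one is $w$, and $f_i(b_i)=f_{i+1}(a_{i+1})$). A *geodesic* of $(M,\mathsf{k}_M)$ is an isometry $\gamma:I\to (M,\mathsf{k}_M)$ defined on an interval $I\subset\mathbb{R}$. Let $S\subset M$ be a *geodesic subspace* of $M$: the space $(S,\mathsf{k}_M|_{S\times S})$ is Cauchy-complete, and any two distinct points of $S$ lie on a geodesic of $(M,\mathsf{k}_M)$ that is contained in $S$. Let $\overline S$ be the closure of $S$ in $\mathbb{C}^d$. The subspace $S$ is called a *visibility subspace* of $M$ if for all $p\ne q$ in $\overline S\setminus S$ there are neighbourhoods $U$ of $p$ and $V$ of $q$ in $\mathbb{C}^d$ with $\overline U\cap\overline V=\emptyset$ and a compact set $K\subset S$ such that the image of every $\mathsf{k}_M$-geodesic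 $\gamma:[a,b]\to S$ with $\gamma(a)\in U$ and $\gamma(b)\in V$ meets $K$. A *geodesic loop* of $S$ in $\overline S$ is an isometry $\gamma:\mathbb{R}\to(S,\mathsf{k}_M|_{S\times S})$ whose set of limit points in $\overline S$ at $+\infty$ equals its set of limit points in $\overline S$ at $-\infty$. Assume that $(S,\mathsf{k}_M|_{S\times S})$ is Gromov hyperbolic, i.e. there is $\delta>0$ such that each side of each geodesic triangle in $S$ lies in the $\delta$-neighbourhood of the union of the other two sides. Let $\overline S^{G}=S\sqcup\partial^G S$ be its Gromov compactification: $\partial^G S$ is the set of geodesic rays of $(S,\mathsf{k}_M|_{S\times S})$ modulo bounded distance. A *generalized ray* from $o\in S$ to $\xi\in\overline S^G$ is a geodesic segment from $o$ to $\xi$ extended by the constant value $\xi$ if $\xi\in S$, and a geodesic ray from $o$ in the class $\xi$ if $\xi\in\partial^G S$. A set $B\subset\overline S^G$ is closed if it contains every $\xi$ for which there are points $u_n\in B$, a base point $o\in S$ and generalized rays $c_n$ from $o$ to $u_n$ such that every subsequence of $(c_n)$ has a further subsequence that converges, uniformly on compact subsets of $[0,\infty)$, to a generalized ray from $o$ to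 $\xi$. Then $S$ is a visibility subspace of $M$ if and only if the identity map $\mathsf{id}_S:S\to S$ extends to a continuous surjective map $\widehat{\mathsf{id}}_S:\overline S^{G}\to\overline S$. Moreover, such an extended map is a homeomorphism if and only if $S$ has no geodesic loops in $\overline S$. -/

import Mathlib

open Set Filter Topology
open scoped NNReal

noncomputable section

/-! ## Embedded complex submanifolds of complex Euclidean space -/

/-- `M` is an embedded (not necessarily closed) complex submanifold of `ℂ^d`: for some `n`, around
each of its points there is a biholomorphic chart between open subsets of `ℂ^d` that carries `M`
to the coordinate slice `ℂ^n × {0}`. -/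
def IsEmbeddedComplexSubmanifold {d : ℕ} (M : Set (EuclideanSpace ℂ (Fin d))) : Prop :=
  ∃ n : ℕ, n ≤ d ∧ ∀ p ∈ M,
    ∃ φ : OpenPartialHomeomorph (EuclideanSpace ℂ (Fin d)) (EuclideanSpace ℂ (Fin d)),
      p ∈ φ.source ∧ DifferentiableOn ℂ φ φ.source ∧ DifferentiableOn ℂ φ.symm φ.target ∧
      ∀ z ∈ φ.source, z ∈ M ↔ ∀ i : Fin d, n ≤ (i : ℕ) → φ z i = 0

/-! ## The Kobayashi distance -/

/-- The Poincaré distance of the open unit disc, normalised so that the infinitesimal metric is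
`|dz| / (1 - |z|²)`. -/
def poincareDist (a b : ℂ) : ℝ :=
  Real.artanh ‖(a - b) / (1 - (starRingEnd ℂ) b * a)‖

/-- `IsDiscChain M z w n p f a b`: the holomorphic discs `f 0, …, f (n - 1)` in `M`, with marked
points `a i`, `b i` of the unit disc, form a chain from `z` to `w` through the points `p i`.
(For an embedded submanifold `M`, holomorphic maps into `M` are the holomorphic maps into
`ℂ^d` with values in `M`.) -/
def IsDiscChain {d : ℕ} (M : Set (EuclideanSpace ℂ (Fin d))) (z w : EuclideanSpace ℂ (Fin d))
    (n : ℕ) (p : ℕ → EuclideanSpace ℂ (Fin d)) (f : ℕ → ℂ → EuclideanSpace ℂ (Fin d))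
    (a b : ℕ → ℂ) : Prop :=
  p 0 = z ∧ p n = w ∧ ∀ i < n,
    DifferentiableOn ℂ (f i) (Metric.ball 0 1) ∧ MapsTo (f i) (Metric.ball 0 1) M ∧
    a i ∈ Metric.ball (0 : ℂ) 1 ∧ b i ∈ Metric.ball (0 : ℂ) 1 ∧
    f i (a i) = p i ∧ f i (b i) = p (i + 1)

/-- The Kobayashi (pseudo)distance `k_M`: the infimum of the Poincaré lengths of chains of
holomorphic discs. When `M` is a connected complex submanifold, any two of its points are joined
by a chain, so that the infimum is over a nonempty set of nonnegative reals. -/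
def kobayashiDist {d : ℕ} (M : Set (EuclideanSpace ℂ (Fin d)))
    (z w : EuclideanSpace ℂ (Fin d)) : ℝ :=
  sInf {r : ℝ | ∃ (n : ℕ) (p : ℕ → EuclideanSpace ℂ (Fin d))
    (f : ℕ → ℂ → EuclideanSpace ℂ (Fin d)) (a b : ℕ → ℂ),
    IsDiscChain M z w n p f a b ∧ r = ∑ i ∈ Finset.range n, poincareDist (a i) (b i)}

/-- The restriction of `k_M` to `S × S`. -/
def kobayashiDistOn {d : ℕ} (M S : Set (EuclideanSpace ℂ (Fin d))) (x y : S) : ℝ :=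
  kobayashiDist M x y

/-! ## Geodesics, completeness and Gromov hyperbolicity for a distance function -/

/-- `γ` restricted to `I ⊆ ℝ` is an isometry into `(X, dist)`. -/
def IsGeodesicOn {X : Type*} (dist : X → X → ℝ) (I : Set ℝ) (γ : ℝ → X) : Prop :=
  ∀ s ∈ I, ∀ t ∈ I, dist (γ s) (γ t) = |s - t|

/-- Every Cauchy sequence for `dist` converges for `dist`. -/
def IsCauchyCompleteDist {X : Type*} (dist : X → X → ℝ) : Prop :=
  ∀ u : ℕ → X, (∀ ε > 0, ∃ N, ∀ m ≥ N, ∀ n ≥ N, dist (u m) (u n) < ε) →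
    ∃ x, Tendsto (fun n => dist (u n) x) atTop (𝓝 0)

/-- `A` is (the image of) a geodesic segment from `x` to `y`. -/
def IsGeodesicSegment {X : Type*} (dist : X → X → ℝ) (x y : X) (A : Set X) : Prop :=
  ∃ (L : ℝ) (γ : ℝ → X), 0 ≤ L ∧ IsGeodesicOn dist (Icc 0 L) γ ∧ γ 0 = x ∧ γ L = y ∧
    A = γ '' Icc 0 L

/-- Gromov hyperbolicity: for some `δ`, each side of each geodesic triangle lies in the
`δ`-neighbourhood of the union of the other two. (The vertices are arbitrary, so it suffices to
express this for one side.) -/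
def IsGromovHyperbolic {X : Type*} (dist : X → X → ℝ) : Prop :=
  ∃ δ > 0, ∀ (x y z : X) (A B C : Set X), IsGeodesicSegment dist x y A →
    IsGeodesicSegment dist y z B → IsGeodesicSegment dist z x C →
    ∀ p ∈ A, ∃ q ∈ B ∪ C, dist p q < δ

/-! ## The Gromov compactification of a proper geodesic Gromov hyperbolic space -/

/-- Geodesic rays in `(X, dist)`. -/
def GeodesicRay {X : Type*} (dist : X → X → ℝ) : Type _ :=
  {γ : ℝ≥0 → X // ∀ s t : ℝ≥0, dist (γ s) (γ t) = |(s : ℝ) - t|}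

/-- Two geodesic rays are asymptotic if they stay at bounded distance from one another. -/
def GeodesicRay.Asymptotic {X : Type*} {dist : X → X → ℝ} (γ η : GeodesicRay dist) : Prop :=
  ∃ C : ℝ, ∀ t : ℝ≥0, dist (γ.1 t) (η.1 t) ≤ C

/-- The Gromov boundary: asymptoty classes of geodesic rays. (`Asymptotic` is an equivalence
relation whenever `dist` is a distance.) -/
def GromovBoundary {X : Type*} (dist : X → X → ℝ) : Type _ :=
  Quot (GeodesicRay.Asymptotic (dist := dist))

/-- The underlying set of the Gromov compactification, the disjoint union of `X` and its Gromov
boundary. -/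
inductive GromovCompactification {X : Type*} (dist : X → X → ℝ) : Type _
  | of (x : X) : GromovCompactification dist
  | bdry (σ : GromovBoundary dist) : GromovCompactification dist

/-- `c` is a generalized ray from `o` to `ξ`: either a geodesic segment from `o` to the point
`ξ ∈ X`, extended by the constant value `ξ`, or a geodesic ray from `o` in the class `ξ`. -/
def IsGeneralizedRay {X : Type*} (dist : X → X → ℝ) (o : X) (c : ℝ≥0 → X) :
    GromovCompactification dist → Prop
  | .of x => c 0 = o ∧ ∃ R : ℝ≥0, (∀ s ≤ R, ∀ t ≤ R, dist (c s) (c t) = |(s : ℝ) - t|) ∧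
      ∀ t ≥ R, c t = x
  | .bdry σ => c 0 = o ∧ ∃ γ : GeodesicRay dist, γ.1 = c ∧ Quot.mk _ γ = σ

/-- Convergence of `c n` to `c'`, for `dist`, uniformly on the compact subsets of `[0, ∞)`. -/
def ConvergesLocallyUniformly {X : Type*} (dist : X → X → ℝ) (c : ℕ → ℝ≥0 → X)
    (c' : ℝ≥0 → X) : Prop :=
  ∀ R : ℝ≥0, ∀ ε > 0, ∃ N, ∀ n ≥ N, ∀ t ≤ R, dist (c n t) (c' t) < ε

/-- Convergence of sequences in the Gromov compactification: `u n → ξ` if, for some base point `o`,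
there are generalized rays `c n` from `o` to `u n` such that each subsequence of `(c n)` has a
further subsequence that converges locally uniformly to a generalized ray from `o` to `ξ`.
(In a proper geodesic Gromov hyperbolic space this does not depend on the base point.) -/
def GromovConverges {X : Type*} (dist : X → X → ℝ) (u : ℕ → GromovCompactification dist)
    (ξ : GromovCompactification dist) : Prop :=
  ∃ (o : X) (c : ℕ → ℝ≥0 → X), (∀ n, IsGeneralizedRay dist o (c n) (u n)) ∧
    ∀ φ : ℕ → ℕ, StrictMono φ → ∃ ψ : ℕ → ℕ, StrictMono ψ ∧ ∃ c' : ℝ≥0 → X,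
      IsGeneralizedRay dist o c' ξ ∧ ConvergesLocallyUniformly dist (fun n => c (φ (ψ n))) c'

theorem GromovConverges.subseq {X : Type*} {dist : X → X → ℝ}
    {u : ℕ → GromovCompactification dist} {ξ : GromovCompactification dist}
    (h : GromovConverges dist u ξ) {φ : ℕ → ℕ} (hφ : StrictMono φ) :
    GromovConverges dist (fun n => u (φ n)) ξ := by
  obtain ⟨o, c, hc, hs⟩ := h
  exact ⟨o, fun n => c (φ n), fun n => hc _, fun θ hθ => hs (φ ∘ θ) (hφ.comp hθ)⟩

/-- The topology of the Gromov compactification: the closed sets are the sets that are closed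
under convergence of sequences in the sense of `GromovConverges`. -/
instance GromovCompactification.instTopologicalSpace {X : Type*} (dist : X → X → ℝ) :
    TopologicalSpace (GromovCompactification dist) :=
  TopologicalSpace.ofClosed
    {B | ∀ u ξ, (∀ n : ℕ, u n ∈ B) → GromovConverges dist u ξ → ξ ∈ B}
    (fun _ _ h _ => h 0)
    (fun _ hA u ξ hu h B hB => hA hB u ξ (fun n => hu n B hB) h)
    (by
      intro A hA B hB u ξ hu h
      by_cases hf : ∃ᶠ n in atTop, u n ∈ A
      · obtain ⟨φ, hφ, hφA⟩ := extraction_of_frequently_atTop hf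
        exact Or.inl (hA _ ξ hφA (h.subseq hφ))
      · have hf' : ∃ᶠ n in atTop, u n ∈ B := by
          refine Eventually.frequently ?_
          filter_upwards [not_frequently.mp hf] with n hn
          exact (hu n).resolve_left hn
        obtain ⟨φ, hφ, hφB⟩ := extraction_of_frequently_atTop hf'
        exact Or.inr (hB _ ξ hφB (h.subseq hφ)))

/-! ## Geodesic subspaces, visibility and geodesic loops -/

/-- `S` is a geodesic subspace of `M`: a subset such that `(S, k_M)` is Cauchy-complete and any two
distinct points of `S` lie on a geodesic of `(M, k_M)` (an isometry from an interval) that is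
contained in `S`. -/
def IsGeodesicSubspace {d : ℕ} (M S : Set (EuclideanSpace ℂ (Fin d))) : Prop :=
  S ⊆ M ∧ IsCauchyCompleteDist (kobayashiDistOn M S) ∧
    ∀ x ∈ S, ∀ y ∈ S, x ≠ y → ∃ (I : Set ℝ) (γ : ℝ → EuclideanSpace ℂ (Fin d)),
      I.OrdConnected ∧ IsGeodesicOn (kobayashiDist M) I γ ∧ MapsTo γ I S ∧
      x ∈ γ '' I ∧ y ∈ γ '' I

/-- `S` is a visibility subspace of `M`. -/
def IsVisibilitySubspace {d : ℕ} (M S : Set (EuclideanSpace ℂ (Fin d))) : Prop :=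
  IsGeodesicSubspace M S ∧ ∀ p ∈ closure S \ S, ∀ q ∈ closure S \ S, p ≠ q →
    ∃ U ∈ 𝓝 p, ∃ V ∈ 𝓝 q, ∃ K : Set (EuclideanSpace ℂ (Fin d)), K ⊆ S ∧ IsCompact K ∧
      Disjoint (closure U) (closure V) ∧
      ∀ (a b : ℝ) (γ : ℝ → EuclideanSpace ℂ (Fin d)), a ≤ b → MapsTo γ (Icc a b) S →
        IsGeodesicOn (kobayashiDist M) (Icc a b) γ → γ a ∈ U → γ b ∈ V →
        (γ '' Icc a b ∩ K).Nonempty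

/-- `γ` is a geodesic loop of `(X, dist)` in the compactification `ι : X → Y`: a geodesic line
whose sets of limit points in `Y` at `+∞` and at `-∞` are equal. -/
def IsGeodesicLoop {X Y : Type*} [TopologicalSpace Y] (dist : X → X → ℝ) (ι : X → Y)
    (γ : ℝ → X) : Prop :=
  IsGeodesicOn dist univ γ ∧
    {p : Y | MapClusterPt p atTop (ι ∘ γ)} = {p : Y | MapClusterPt p atBot (ι ∘ γ)}

/-- `Φ` is a continuous surjection from the Gromov compactification of `(S, k_M)` onto the
Euclidean closure of `S` that extends the identity map of `S`. -/
def IsContinuousSurjectiveExtension {d : ℕ} (M S : Set (EuclideanSpace ℂ (Fin d)))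
    (Φ : GromovCompactification (kobayashiDistOn M S) → closure S) : Prop :=
  Continuous Φ ∧ Function.Surjective Φ ∧ ∀ x : S, Φ (.of x) = inclusion subset_closure x

end

/-! ## The Kobayashi distance of a bounded connected submanifold -/

section Kobayashi

variable {d : ℕ} {M : Set (EuclideanSpace ℂ (Fin d))} {z w v : EuclideanSpace ℂ (Fin d)}

/-! The complex geometry serves only to make `S` a proper geodesic metric space. As `M` is bounded,
the Schwarz lemma bounds the Euclidean distance by a multiple of `k_M`; discs in slice charts make
`k_M` small near each point. So `k_M` is a metric inducing the Euclidean topology on `S`.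
Completeness gives `S = M ∩ closure S`, hence local compactness, and Hopf–Rinow gives properness.
The rest concerns a dense embedding `ι : X → Y` of such a space in a compact metric space
(`isVisibilityCompactification_iff`).

Visibility gives an extension: if geodesics converge to a ray and their far points tended to a limit
other than that of the ray, their tails would join neighbourhoods of two boundary points while
leaving every compact set (`eq_of_tendsto`). So rays have limits, and these limits depend
continuously on the class. Density and Arzelà–Ascoli give surjectivity.

Hyperbolicity enters in the converse. If visibility fails at `p ≠ q`, there are geodesics from
points near `p` to points near `q` that escape to infinity. Slim triangles then make the rays from a
base point towards `p` and towards `q` asymptotic, so a continuous extension would map one boundary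
point to both `p` and `q`.

Finally, the extension is always a closed map (`IsSlim.isClosedMap`), so it is a homeomorphism iff
it is injective. It sends the Gromov boundary off `S`, so only two boundary classes can be
identified; these are the ends of a geodesic line (`IsSlim.exists_line`), which is then a loop.
Conversely, the two ends of a loop are distinct classes with the same image. -/

theorem poincareDist_nonneg (a b : ℂ) : 0 ≤ poincareDist a b :=
  Real.artanh_nonneg (norm_nonneg _)

theorem poincareDist_comm (a b : ℂ) : poincareDist a b = poincareDist b a := by
  unfold poincareDist
  congr 1
  rw [norm_div, norm_div, norm_sub_rev a b]
  congr 1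
  rw [← Complex.norm_conj]
  simp [mul_comm]

/-- The lengths of the chains of discs from `z` to `w`. -/
def chainLengths (M : Set (EuclideanSpace ℂ (Fin d))) (z w : EuclideanSpace ℂ (Fin d)) : Set ℝ :=
  {r : ℝ | ∃ (n : ℕ) (p : ℕ → EuclideanSpace ℂ (Fin d))
    (f : ℕ → ℂ → EuclideanSpace ℂ (Fin d)) (a b : ℕ → ℂ),
    IsDiscChain M z w n p f a b ∧ r = ∑ i ∈ Finset.range n, poincareDist (a i) (b i)}

theorem kobayashiDist_eq_sInf : kobayashiDist M z w = sInf (chainLengths M z w) := rfl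

theorem chainLengths_nonneg {r : ℝ} (hr : r ∈ chainLengths M z w) : 0 ≤ r := by
  obtain ⟨n, p, f, a, b, -, rfl⟩ := hr
  exact Finset.sum_nonneg fun _ _ => poincareDist_nonneg _ _

theorem bddBelow_chainLengths : BddBelow (chainLengths M z w) :=
  ⟨0, fun _ => chainLengths_nonneg⟩

theorem zero_mem_chainLengths : 0 ∈ chainLengths M z z :=
  ⟨0, fun _ => z, fun _ _ => z, 0, 0, ⟨rfl, rfl, by simp⟩, by simp⟩

theorem poincareDist_mem_chainLengths {f : ℂ → EuclideanSpace ℂ (Fin d)} {a b : ℂ}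
    (hf : DifferentiableOn ℂ f (Metric.ball 0 1)) (hfM : MapsTo f (Metric.ball 0 1) M)
    (ha : a ∈ Metric.ball (0 : ℂ) 1) (hb : b ∈ Metric.ball (0 : ℂ) 1) :
    poincareDist a b ∈ chainLengths M (f a) (f b) :=
  ⟨1, fun i => if i = 0 then f a else f b, fun _ => f, fun _ => a, fun _ => b,
    ⟨by simp, by simp, fun i hi => by
      obtain rfl : i = 0 := by omega
      exact ⟨hf, hfM, ha, hb, by simp, by simp⟩⟩, by simp⟩

theorem chainLengths_symm {r : ℝ} (hr : r ∈ chainLengths M z w) : r ∈ chainLengths M w z := by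
  obtain ⟨n, p, f, a, b, ⟨h0, hn, h⟩, rfl⟩ := hr
  refine ⟨n, fun i => p (n - i), fun i => f (n - 1 - i), fun i => b (n - 1 - i),
    fun i => a (n - 1 - i), ⟨by simpa using hn, by simpa using h0, fun i hi => ?_⟩, ?_⟩
  · obtain ⟨h1, h2, h3, h4, h5, h6⟩ := h (n - 1 - i) (by omega)
    refine ⟨h1, h2, h4, h3, ?_, ?_⟩
    · exact h6.trans (congrArg p (by omega))
    · exact h5.trans (congrArg p (by omega))
  · rw [← Finset.sum_range_reflect]
    exact Finset.sum_congr rfl fun i _ => poincareDist_comm _ _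

theorem chainLengths_add {r s : ℝ} (hr : r ∈ chainLengths M z w) (hs : s ∈ chainLengths M w v) :
    r + s ∈ chainLengths M z v := by
  obtain ⟨n, p, f, a, b, ⟨h0, hn, h⟩, rfl⟩ := hr
  obtain ⟨m, p', f', a', b', ⟨h0', hm', h'⟩, rfl⟩ := hs
  -- The junction index `n` is read from the second chain, where the point is again `w`. This is why
  -- the cases `n = 0` and `i + 1 = n` need separate care below.
  refine ⟨n + m, fun i => if i < n then p i else p' (i - n),
    fun i => if i < n then f i else f' (i - n), fun i => if i < n then a i else a' (i - n),
    fun i => if i < n then b i else b' (i - n), ⟨?_, ?_, fun i hi => ?_⟩, ?_⟩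
  · rcases Nat.eq_zero_or_pos n with rfl | hpos
    · simp [h0', ← h0, hn]
    · simp [hpos, h0]
  · simp [hm']
  · by_cases hin : i < n
    · obtain ⟨h1, h2, h3, h4, h5, h6⟩ := h i hin
      simp only [hin, if_true]
      refine ⟨h1, h2, h3, h4, h5, ?_⟩
      split_ifs with hi'
      · exact h6
      · obtain rfl : n = i + 1 := by omega
        simp [h6, hn, h0']
    · obtain ⟨h1, h2, h3, h4, h5, h6⟩ := h' (i - n) (by omega)
      have hi' : ¬ i + 1 < n := by omega
      simp only [hin, hi', if_false]
      refine ⟨h1, h2, h3, h4, h5, ?_⟩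
      rw [h6]; congr 1; omega
  · rw [Finset.sum_range_add]
    congr 1
    · exact Finset.sum_congr rfl fun i hi => by simp [Finset.mem_range.1 hi]
    · simp

theorem kobayashiDist_nonneg : 0 ≤ kobayashiDist M z w :=
  Real.sInf_nonneg fun _ => chainLengths_nonneg

theorem kobayashiDist_self : kobayashiDist M z z = 0 :=
  le_antisymm (csInf_le bddBelow_chainLengths zero_mem_chainLengths) kobayashiDist_nonneg

theorem kobayashiDist_comm : kobayashiDist M z w = kobayashiDist M w z := by
  rw [kobayashiDist_eq_sInf, kobayashiDist_eq_sInf]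
  exact congrArg sInf (Set.ext fun _ => ⟨chainLengths_symm, chainLengths_symm⟩)

theorem kobayashiDist_triangle (h₁ : (chainLengths M z w).Nonempty)
    (h₂ : (chainLengths M w v).Nonempty) :
    kobayashiDist M z v ≤ kobayashiDist M z w + kobayashiDist M w v := by
  refine le_of_forall_pos_lt_add fun ε hε => ?_
  obtain ⟨r, hr, hrε⟩ := exists_lt_of_csInf_lt h₁
    (lt_add_of_pos_right (kobayashiDist M z w) (half_pos hε))
  obtain ⟨s, hs, hsε⟩ := exists_lt_of_csInf_lt h₂
    (lt_add_of_pos_right (kobayashiDist M w v) (half_pos hε))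
  have := csInf_le bddBelow_chainLengths (chainLengths_add hr hs)
  rw [← kobayashiDist_eq_sInf] at this
  linarith

/-! ### Comparison with the Euclidean distance by the Schwarz lemma. -/

/-- Follows from `log y ≥ 1 - 1/y` at `y = (1 + x)/(1 - x)`. The factor `1/2` is not sharp, but only
some constant is needed. -/
theorem half_le_artanh {x : ℝ} (h0 : 0 ≤ x) (h1 : x < 1) : x / 2 ≤ Real.artanh x := by
  rw [Real.artanh_eq_half_log ⟨by linarith, h1.le⟩]
  have hpos : 0 < (1 + x) / (1 - x) := div_pos (by linarith) (by linarith)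
  have h := Real.one_sub_inv_le_log_of_pos hpos
  have : x ≤ 1 - ((1 + x) / (1 - x))⁻¹ := by
    rw [inv_div, le_sub_iff_add_le, ← le_sub_iff_add_le', div_le_iff₀ (by linarith)]
    nlinarith
  linarith

theorem one_add_conj_mul_ne_zero {b u : ℂ} (hb : ‖b‖ < 1) (hu : ‖u‖ < 1) :
    1 + (starRingEnd ℂ) b * u ≠ 0 := by
  intro h
  have h' : (starRingEnd ℂ) b * u = -1 := by linear_combination h
  have := congrArg norm h'
  rw [norm_mul, Complex.norm_conj, norm_neg, norm_one] at this
  nlinarith [norm_nonneg b, norm_nonneg u]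

theorem normSq_one_add_conj_mul_sub (b u : ℂ) :
    ‖1 + (starRingEnd ℂ) b * u‖ ^ 2 - ‖u + b‖ ^ 2 = (1 - ‖b‖ ^ 2) * (1 - ‖u‖ ^ 2) := by
  simp only [← Complex.normSq_eq_norm_sq, Complex.normSq_apply]
  simp
  ring

theorem norm_moebius_lt_one {b u : ℂ} (hb : ‖b‖ < 1) (hu : ‖u‖ < 1) :
    ‖(u + b) / (1 + (starRingEnd ℂ) b * u)‖ < 1 := by
  have hpos := norm_pos_iff.2 (one_add_conj_mul_ne_zero hb hu)
  rw [norm_div, div_lt_one hpos]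
  refine lt_of_pow_lt_pow_left₀ 2 hpos.le ?_
  have := normSq_one_add_conj_mul_sub b u
  have : 0 < (1 - ‖b‖ ^ 2) * (1 - ‖u‖ ^ 2) :=
    mul_pos (by nlinarith [norm_nonneg b]) (by nlinarith [norm_nonneg u])
  linarith

/-- Precomposing with the Möbius map `m` that takes `0` to `b` reduces to the Schwarz lemma at the
centre. The constant is `2 * 2R`: the image lies in the ball of radius `2R` about `f b`, and `‖u‖ ≤
2 artanh ‖u‖`. -/
theorem dist_le_mul_poincareDist {f : ℂ → EuclideanSpace ℂ (Fin d)} {R : ℝ} {a b : ℂ}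
    (hf : DifferentiableOn ℂ f (Metric.ball 0 1))
    (hfR : MapsTo f (Metric.ball 0 1) (Metric.closedBall 0 R))
    (ha : a ∈ Metric.ball (0 : ℂ) 1) (hb : b ∈ Metric.ball (0 : ℂ) 1) :
    dist (f a) (f b) ≤ 4 * R * poincareDist a b := by
  have ha' : ‖a‖ < 1 := by simpa using ha
  have hb' : ‖b‖ < 1 := by simpa using hb
  have hR : 0 ≤ R := Metric.nonempty_closedBall.1 ⟨_, hfR ha⟩
  set m : ℂ → ℂ := fun u => (u + b) / (1 + (starRingEnd ℂ) b * u) with hm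
  have hmaps : MapsTo m (Metric.ball 0 1) (Metric.ball 0 1) := fun u hu =>
    mem_ball_zero_iff.2 (norm_moebius_lt_one hb' (by simpa using hu))
  have hmd : DifferentiableOn ℂ m (Metric.ball 0 1) := by
    refine DifferentiableOn.div (by fun_prop) (by fun_prop) fun u hu => ?_
    exact one_add_conj_mul_ne_zero hb' (by simpa using hu)
  set u : ℂ := (a - b) / (1 - (starRingEnd ℂ) b * a) with hu
  have hu1 : ‖u‖ < 1 := by
    have := norm_moebius_lt_one (b := -b) (u := a) (by simpa using hb') ha'
    simpa [hu, sub_eq_add_neg] using this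
  have hden : 1 - (starRingEnd ℂ) b * a ≠ 0 := by
    have := one_add_conj_mul_ne_zero (b := -b) (u := a) (by simpa using hb') ha'
    simpa [sub_eq_add_neg] using this
  have hmu : m u = a := by
    have h2 := one_add_conj_mul_ne_zero hb' hu1
    simp only [hm]
    have e : u * (1 - (starRingEnd ℂ) b * a) = a - b := div_mul_cancel₀ _ hden
    rw [div_eq_iff h2]
    linear_combination e
  have hm0 : m 0 = b := by simp [hm]
  have h0 : (0 : ℂ) ∈ Metric.ball (0 : ℂ) 1 := by simp
  have key := Complex.dist_le_div_mul_dist_of_mapsTo_ball (f := f ∘ m) (c := 0) (R₁ := 1)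
    (R₂ := 2 * R) (z := u) (hf.comp hmd hmaps) (fun x hx => by
      have h1 := hfR (hmaps hx)
      have h2 := hfR (hmaps h0)
      rw [Metric.mem_closedBall] at h1 h2 ⊢
      have := dist_triangle_right (f (m x)) (f (m 0)) 0
      simp only [Function.comp]
      linarith) (by simpa using hu1)
  simp only [Function.comp, hmu, hm0, div_one, dist_zero_right] at key
  have := half_le_artanh (norm_nonneg u) hu1
  have hp : poincareDist a b = Real.artanh ‖u‖ := rfl
  rw [hp]
  nlinarith

theorem dist_le_mul_kobayashiDist {R : ℝ} (hM : M ⊆ Metric.closedBall 0 R) (hR : 0 ≤ R)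
    (hne : (chainLengths M z w).Nonempty) : dist z w ≤ 4 * R * kobayashiDist M z w := by
  have main : ∀ r ∈ chainLengths M z w, dist z w ≤ 4 * R * r := by
    rintro _ ⟨n, p, f, a, b, ⟨rfl, rfl, h⟩, rfl⟩
    calc dist (p 0) (p n) ≤ ∑ i ∈ Finset.range n, dist (p i) (p (i + 1)) :=
          dist_le_range_sum_dist _ _
      _ ≤ ∑ i ∈ Finset.range n, 4 * R * poincareDist (a i) (b i) := by
          refine Finset.sum_le_sum fun i hi => ?_
          obtain ⟨h1, h2, h3, h4, h5, h6⟩ := h i (Finset.mem_range.1 hi)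
          rw [← h5, ← h6]
          exact dist_le_mul_poincareDist h1 (fun x hx => hM (h2 hx)) h3 h4
      _ = _ := by rw [Finset.mul_sum]
  rcases hR.eq_or_lt with rfl | hR
  · obtain ⟨r, hr⟩ := hne
    simpa using main r hr
  · rw [← div_le_iff₀' (by positivity)]
    exact le_csInf hne fun r hr => by
      rw [div_le_iff₀' (by positivity)]
      exact main r hr

/-! ### Local consequences of slice charts. -/

/-- Near a point of an embedded submanifold, the submanifold is joined to this point by single
holomorphic discs of small Poincaré length. -/
theorem IsEmbeddedComplexSubmanifold.eventually_exists_chainLengths_lt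
    (hM : IsEmbeddedComplexSubmanifold M) {p : EuclideanSpace ℂ (Fin d)} (hp : p ∈ M)
    {ε : ℝ} (hε : 0 < ε) : ∀ᶠ w in 𝓝[M] p, ∃ r ∈ chainLengths M p w, r < ε := by
  obtain ⟨n, -, hn⟩ := hM
  obtain ⟨φ, hpφ, -, hφ', hφM⟩ := hn p hp
  obtain ⟨r, hr, hball⟩ := Metric.isOpen_iff.1 φ.open_target (φ p) (φ.map_source hpφ)
  -- The point `s` has Poincaré distance `ε / 2` from `0`. The affine disc `g` below runs in the
  -- slice from `φ p` at `0` to `φ w` at `s`, and stays in the ball of radius `r` once `φ w` is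
  -- within `s * r` of `φ p`.
  set s := Real.tanh (ε / 2) with hs
  have hs1 : s < 1 := Real.tanh_lt_one _
  have hs0 : 0 < s := by
    by_contra! h
    have := Real.artanh_nonpos h
    rw [hs, Real.artanh_tanh] at this
    linarith
  have hsr : 0 < s * r := mul_pos hs0 hr
  have h1 : ∀ᶠ w in 𝓝[M] p, w ∈ φ.source :=
    nhdsWithin_le_nhds (φ.open_source.mem_nhds hpφ)
  have h2 : ∀ᶠ w in 𝓝[M] p, φ w ∈ Metric.ball (φ p) (s * r) :=
    nhdsWithin_le_nhds ((φ.continuousAt hpφ).eventually (Metric.ball_mem_nhds _ hsr))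
  filter_upwards [h1, h2, self_mem_nhdsWithin] with w hw1 hw2 hwM
  set g : ℂ → EuclideanSpace ℂ (Fin d) := fun u => φ p + (u / (s : ℂ)) • (φ w - φ p) with hg
  have hgt : MapsTo g (Metric.ball 0 1) φ.target := fun u hu => by
    apply hball
    have hu' : ‖u‖ < 1 := by simpa using hu
    rw [mem_ball_iff_norm] at hw2 ⊢
    simp only [hg, add_sub_cancel_left, norm_smul, norm_div, Complex.norm_real, Real.norm_eq_abs,
      abs_of_pos hs0]
    calc ‖u‖ / s * ‖φ w - φ p‖ ≤ 1 / s * ‖φ w - φ p‖ := by gcongr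
      _ < 1 / s * (s * r) := by gcongr
      _ = r := by field_simp
  have hgM : ∀ u, ∀ i : Fin d, n ≤ (i : ℕ) → g u i = 0 := fun u i hi => by
    have e1 := (hφM p hpφ).1 hp i hi
    have e2 := (hφM w hw1).1 hwM i hi
    simp [hg, e1, e2]
  have hs' : (s : ℂ) ≠ 0 := by exact_mod_cast hs0.ne'
  refine ⟨poincareDist 0 s, ?_, ?_⟩
  · have := poincareDist_mem_chainLengths (M := M) (f := φ.symm ∘ g) (a := 0) (b := s)
      (hφ'.comp (by fun_prop) hgt) (fun u hu => ?_) (by simp) (by simpa [abs_of_pos hs0] using hs1)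
    · simpa [hg, hs', φ.left_inv hpφ, φ.left_inv hw1] using this
    · refine (hφM _ (φ.map_target (hgt hu))).2 fun i hi => ?_
      rw [φ.right_inv (hgt hu)]
      exact hgM u i hi
  · have : poincareDist 0 s = ε / 2 := by
      rw [← Real.artanh_tanh (ε / 2), ← hs]
      simp [poincareDist, abs_of_pos hs0]
    linarith

/-- Being joined by a chain is symmetric, transitive and holds locally, so connectedness makes it
hold everywhere. -/
theorem IsEmbeddedComplexSubmanifold.chainLengths_nonempty
    (hM : IsEmbeddedComplexSubmanifold M) (hMc : IsConnected M) (hz : z ∈ M) (hw : w ∈ M) :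
    (chainLengths M z w).Nonempty := by
  refine hMc.isPreconnected.induction₂ (fun x y => (chainLengths M x y).Nonempty) (fun x hx => ?_)
    (fun x y z _ _ _ h₁ h₂ => ?_) (fun x y _ _ h => ?_) hz hw
  · filter_upwards [hM.eventually_exists_chainLengths_lt hx one_pos] with y hy
    exact hy.imp fun _ h => h.1
  · exact ⟨_, chainLengths_add h₁.some_mem h₂.some_mem⟩
  · exact ⟨_, chainLengths_symm h.some_mem⟩

theorem IsEmbeddedComplexSubmanifold.eventually_kobayashiDist_lt
    (hM : IsEmbeddedComplexSubmanifold M) {p : EuclideanSpace ℂ (Fin d)} (hp : p ∈ M)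
    {ε : ℝ} (hε : 0 < ε) : ∀ᶠ w in 𝓝[M] p, kobayashiDist M p w < ε := by
  filter_upwards [hM.eventually_exists_chainLengths_lt hp hε] with w ⟨r, hr, hrε⟩
  exact (csInf_le bddBelow_chainLengths hr).trans_lt hrε

/-- Within a chart domain, `M` is the common zero set of continuous coordinates. -/
theorem IsEmbeddedComplexSubmanifold.isLocallyClosed (hM : IsEmbeddedComplexSubmanifold M) :
    IsLocallyClosed M := by
  obtain ⟨n, -, hn⟩ := hM
  refine ((isLocallyClosed_tfae M).out 0 3).2 fun p hp => ?_
  obtain ⟨φ, hpφ, -, -, hφM⟩ := hn p hp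
  refine ⟨φ.source, hpφ, φ.open_source, fun y ⟨hy, hyM⟩ => (hφM y hy).2 fun i hi => ?_⟩
  have : (𝓝[M] y).NeBot := mem_closure_iff_nhdsWithin_neBot.1 hyM
  have h1 : Tendsto (fun w => φ w i) (𝓝[M] y) (𝓝 (φ y i)) :=
    (((EuclideanSpace.proj (𝕜 := ℂ) i).continuous.tendsto _).comp (φ.continuousAt hy)).mono_left
      nhdsWithin_le_nhds
  refine tendsto_nhds_unique (h1.congr' (f₂ := fun _ => 0) ?_) tendsto_const_nhds
  filter_upwards [nhdsWithin_le_nhds (φ.open_source.mem_nhds hy), self_mem_nhdsWithin] with w h1 h2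
  exact (hφM w h1).1 h2 i hi

end Kobayashi

/-! ## Proper geodesic metric spaces -/

section Geodesic

open scoped ENNReal

variable {X : Type*} [MetricSpace X]

/-- Any two points are joined by a geodesic segment. -/
def IsGeodesicSpace (X : Type*) [MetricSpace X] : Prop :=
  ∀ x y : X, ∃ γ : ℝ → X, IsGeodesicOn dist (Icc 0 (dist x y)) γ ∧ γ 0 = x ∧ γ (dist x y) = y

/-- The point `y` lies on a geodesic from `o` to `x`, at distance `min r (dist o x)` from `o`. Hence
a ball is contained in a thickening of a smaller concentric one. -/
theorem IsGeodesicSpace.exists_dist_le (h : IsGeodesicSpace X) {o x : X} {r ε : ℝ} (hr : 0 ≤ r)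
    (hε : 0 ≤ ε) (hx : dist o x ≤ r + ε) : ∃ y, dist o y ≤ r ∧ dist x y ≤ ε := by
  obtain ⟨γ, hγ, h0, h1⟩ := h o x
  have hm : min r (dist o x) ∈ Icc 0 (dist o x) := ⟨le_min hr dist_nonneg, min_le_right _ _⟩
  refine ⟨γ (min r (dist o x)), ?_, ?_⟩
  · nth_rewrite 1 [← h0]
    rw [hγ 0 ⟨le_rfl, dist_nonneg⟩ _ hm, zero_sub, abs_neg, abs_of_nonneg hm.1]
    exact min_le_left _ _
  · nth_rewrite 1 [← h1]
    rw [hγ _ ⟨dist_nonneg, le_rfl⟩ _ hm, abs_of_nonneg (sub_nonneg.2 hm.2), sub_le_comm]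
    exact le_min (by linarith) (by linarith)

/-- The Hopf–Rinow theorem for geodesic metric spaces. -/
theorem IsGeodesicSpace.properSpace [CompleteSpace X] [LocallyCompactSpace X]
    (h : IsGeodesicSpace X) : ProperSpace X := by
  refine ⟨fun o r₀ => ?_⟩
  by_contra hr₀
  set A : Set ℝ := {r | 0 ≤ r ∧ IsCompact (Metric.closedBall o r)} with hA
  have hmono : ∀ r r', r ≤ r' → IsCompact (Metric.closedBall o r') →
      IsCompact (Metric.closedBall o r) := fun r r' hrr' hc =>
    hc.of_isClosed_subset Metric.isClosed_closedBall (Metric.closedBall_subset_closedBall hrr')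
  have h0A : (0 : ℝ) ∈ A := ⟨le_rfl, by simp⟩
  have hbdd : BddAbove A := ⟨r₀, fun r hr => by
    by_contra! hlt
    exact hr₀ (hmono _ _ hlt.le hr.2)⟩
  set s := sSup A
  have hs0 : 0 ≤ s := le_csSup hbdd h0A
  have hlt : ∀ r < s, IsCompact (Metric.closedBall o r) := fun r hr => by
    obtain ⟨r', hr', hrr'⟩ := exists_lt_of_lt_csSup ⟨0, h0A⟩ hr
    exact hmono _ _ hrr'.le hr'.2
  -- The supremum of the compact radii is attained: the ball of radius `s` is complete, and each of
  -- its points is within `η` of the compact ball of radius `s - η`.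
  have hs : IsCompact (Metric.closedBall o s) := by
    rcases hs0.eq_or_lt with hs0 | hs0
    · rw [← hs0]; simp
    refine isCompact_iff_totallyBounded_isComplete.2 ⟨Metric.totallyBounded_iff.2 fun ε hε => ?_,
      Metric.isClosed_closedBall.isComplete⟩
    set η := min (ε / 2) s
    have hη : 0 < η := lt_min (half_pos hε) hs0
    obtain ⟨t, ht, hcov⟩ := Metric.totallyBounded_iff.1
      (hlt (s - η) (by linarith)).totallyBounded (ε / 2) (half_pos hε)
    refine ⟨t, ht, fun x hx => ?_⟩
    obtain ⟨y, hy, hxy⟩ := h.exists_dist_le (o := o) (x := x) (r := s - η) (ε := η)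
      (sub_nonneg.2 (min_le_right _ _)) hη.le (by
        rw [Metric.mem_closedBall, dist_comm] at hx; linarith)
    obtain ⟨z, hz, hyz⟩ := mem_iUnion₂.1 (hcov (Metric.mem_closedBall'.2 hy))
    refine mem_iUnion₂.2 ⟨z, hz, ?_⟩
    rw [Metric.mem_ball] at hyz ⊢
    have := dist_triangle x y z
    have := min_le_left (ε / 2) s
    linarith
  -- Local compactness now enlarges the radius to `s + δ`, contradicting the choice of `s`.
  obtain ⟨K, hK, hsK⟩ := exists_compact_superset hs
  obtain ⟨δ, hδ, hδK⟩ := hs.exists_cthickening_subset_open isOpen_interior hsK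
  have : s + δ ∈ A := by
    refine ⟨by linarith, hK.of_isClosed_subset Metric.isClosed_closedBall fun x hx => ?_⟩
    obtain ⟨y, hy, hxy⟩ := h.exists_dist_le (o := o) (x := x) (r := s) (ε := δ) hs0 hδ.le
      (Metric.mem_closedBall'.1 hx)
    exact interior_subset (hδK (Metric.mem_cthickening_of_dist_le x y δ _
      (Metric.mem_closedBall'.2 hy) hxy))
  have := le_csSup hbdd this
  linarith

/-- The Arzelà–Ascoli theorem for sequences of `1`-Lipschitz maps between proper spaces. -/
theorem exists_subseq_tendsto_of_lipschitz {T : Type*} [MetricSpace T] [ProperSpace T]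
    [ProperSpace X] {c : ℕ → T → X} (hc : ∀ n, LipschitzWith 1 (c n)) (t₀ : T) (o : X) (R : ℝ)
    (h₀ : ∀ n, dist (c n t₀) o ≤ R) :
    ∃ φ : ℕ → ℕ, StrictMono φ ∧ ∃ c' : T → X, LipschitzWith 1 c' ∧
      ∀ r, ∀ ε > 0, ∃ N, ∀ n ≥ N, ∀ t ∈ Metric.closedBall t₀ r, dist (c (φ n) t) (c' t) < ε := by
  set S : Set C(T, X) := {f | LipschitzWith 1 f ∧ dist (f t₀) o ≤ R} with hS
  have hScomp : IsCompact S := by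
    refine ArzelaAscoli.isCompact_of_equicontinuous S ?_
      (LipschitzWith.uniformEquicontinuous _ 1 fun f => f.2.1).equicontinuous
    have himg : ContinuousMap.toFun '' S = {f : T → X | LipschitzWith 1 f ∧ dist (f t₀) o ≤ R} := by
      ext f
      constructor
      · rintro ⟨g, hg, rfl⟩
        exact hg
      · intro hf
        exact ⟨⟨f, hf.1.continuous⟩, hf, rfl⟩
    rw [himg]
    -- Tychonoff: the values at `t` stay in the compact ball of radius `R + dist t t₀`.
    refine (isCompact_univ_pi fun t : T =>
      isCompact_closedBall o (R + dist t t₀)).of_isClosed_subset ?_ fun f hf t _ => ?_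
    · exact (isClosed_setOfPred_lipschitzWith 1).inter
        (isClosed_le ((continuous_apply t₀).dist continuous_const) continuous_const)
    · have h1 := hf.1.dist_le_mul t t₀
      have h2 := dist_triangle (f t) (f t₀) o
      have h3 := hf.2
      rw [Metric.mem_closedBall]
      simp at h1
      linarith
  obtain ⟨c', hc', φ, hφ, hlim⟩ := hScomp.tendsto_subseq
    (x := fun n => (⟨c n, (hc n).continuous⟩ : C(T, X))) fun n => ⟨hc n, h₀ n⟩
  refine ⟨φ, hφ, c', hc'.1, fun r ε hε => ?_⟩
  have h1 := Metric.tendstoUniformlyOn_iff.1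
    (ContinuousMap.tendsto_iff_forall_isCompact_tendstoUniformlyOn.1 hlim _
      (isCompact_closedBall t₀ r)) ε hε
  obtain ⟨N, hN⟩ := eventually_atTop.1 h1
  refine ⟨N, fun n hn t ht => ?_⟩
  rw [dist_comm]
  exact hN n hn t ht

/-! ## Stopped geodesics and generalized rays -/

/-- `c` is a geodesic on `[0, R]` and constant on `[R, ∞)`. -/
def IsStoppedGeodesic (R : ℝ≥0∞) (c : ℝ≥0 → X) : Prop :=
  ∀ s t : ℝ≥0, dist (c s) (c t) = |(min (s : ℝ≥0∞) R).toReal - (min (t : ℝ≥0∞) R).toReal|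

variable {R : ℝ≥0∞} {c c' : ℝ≥0 → X} {o : X}

theorem toReal_min_of_le {s : ℝ≥0} (hs : s ≤ R) : (min (s : ℝ≥0∞) R).toReal = s := by
  rw [min_eq_left hs, ENNReal.coe_toReal]

theorem abs_toReal_min_sub_le (s t : ℝ≥0) :
    |(min (s : ℝ≥0∞) R).toReal - (min (t : ℝ≥0∞) R).toReal| ≤ |(s : ℝ) - t| := by
  rcases eq_or_ne R ⊤ with rfl | hR
  · simp
  · lift R to ℝ≥0 using hR
    rw [← ENNReal.coe_min, ← ENNReal.coe_min, ENNReal.coe_toReal, ENNReal.coe_toReal,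
      NNReal.coe_min, NNReal.coe_min]
    refine (abs_min_sub_min_le_max _ _ _ _).trans ?_
    simp

theorem IsStoppedGeodesic.lipschitzWith (h : IsStoppedGeodesic R c) : LipschitzWith 1 c :=
  LipschitzWith.of_dist_le_mul fun s t => by
    rw [h s t, NNReal.coe_one, one_mul, NNReal.dist_eq]
    exact abs_toReal_min_sub_le s t

theorem IsStoppedGeodesic.dist_eq (h : IsStoppedGeodesic R c) {s t : ℝ≥0} (hs : s ≤ R)
    (ht : t ≤ R) : dist (c s) (c t) = |(s : ℝ) - t| := by
  rw [h s t, toReal_min_of_le hs, toReal_min_of_le ht]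

theorem IsStoppedGeodesic.dist_zero (h : IsStoppedGeodesic R c) {t : ℝ≥0} (ht : t ≤ R) :
    dist (c 0) (c t) = t := by
  rw [h.dist_eq (by simp) ht]
  simp

theorem IsStoppedGeodesic.isGeodesicOn (h : IsStoppedGeodesic R c) {a b : ℝ} (ha : 0 ≤ a)
    (hb : b.toNNReal ≤ R) : IsGeodesicOn dist (Icc a b) fun t => c t.toNNReal := by
  intro s hs t ht
  rw [h.dist_eq ((ENNReal.coe_le_coe.2 (Real.toNNReal_mono hs.2)).trans hb)
    ((ENNReal.coe_le_coe.2 (Real.toNNReal_mono ht.2)).trans hb),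
    Real.coe_toNNReal _ (ha.trans hs.1), Real.coe_toNNReal _ (ha.trans ht.1)]

theorem isStoppedGeodesic_coe {r : ℝ≥0} (h : ∀ s ≤ r, ∀ t ≤ r, dist (c s) (c t) = |(s : ℝ) - t|)
    (h' : ∀ t ≥ r, c t = c r) : IsStoppedGeodesic r c := by
  have key : ∀ t, c t = c (min t r) := fun t => by
    rcases le_total t r with ht | ht
    · rw [min_eq_left ht]
    · rw [min_eq_right ht, h' t ht]
  intro s t
  rw [key s, key t, h _ (min_le_right _ _) _ (min_le_right _ _), ← ENNReal.coe_min,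
    ← ENNReal.coe_min, ENNReal.coe_toReal, ENNReal.coe_toReal]

theorem IsGeodesicSpace.exists_isStoppedGeodesic (h : IsGeodesicSpace X) (x y : X) :
    ∃ c : ℝ≥0 → X, IsStoppedGeodesic (nndist x y) c ∧ c 0 = x ∧ c (nndist x y) = y := by
  obtain ⟨γ, hγ, h0, h1⟩ := h x y
  refine ⟨fun t => γ (min t (nndist x y) : ℝ≥0), isStoppedGeodesic_coe (fun s hs t ht => ?_)
    (fun t ht => ?_), by simpa using h0, by simpa using h1⟩
  · rw [min_eq_left hs, min_eq_left ht]
    exact hγ _ ⟨s.2, by exact_mod_cast hs⟩ _ ⟨t.2, by exact_mod_cast ht⟩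
  · simp [min_eq_right ht]

/-- The ray underlying a stopped geodesic that is never stopped. -/
def IsStoppedGeodesic.ray (h : IsStoppedGeodesic ⊤ c) : GeodesicRay (dist : X → X → ℝ) :=
  ⟨c, fun _ _ => h.dist_eq le_top le_top⟩

theorem GeodesicRay.isStoppedGeodesic (γ : GeodesicRay (dist : X → X → ℝ)) :
    IsStoppedGeodesic ⊤ γ.1 := fun s t => by
  simpa using γ.2 s t

/-- The end point in the Gromov compactification of a stopped geodesic. -/
theorem IsStoppedGeodesic.isGeneralizedRay_coe {r : ℝ≥0} (h : IsStoppedGeodesic r c)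
    (h0 : c 0 = o) : IsGeneralizedRay dist o c (.of (c r)) := by
  refine ⟨h0, r, fun s hs t ht => h.dist_eq (by exact_mod_cast hs) (by exact_mod_cast ht),
    fun t ht => ?_⟩
  have := h t r
  rw [min_eq_right (by exact_mod_cast ht), min_self, sub_self, abs_zero] at this
  exact dist_eq_zero.1 this

theorem IsStoppedGeodesic.isGeneralizedRay_top (h : IsStoppedGeodesic ⊤ c) (h0 : c 0 = o) :
    IsGeneralizedRay dist o c (.bdry (Quot.mk _ h.ray)) :=
  ⟨h0, h.ray, rfl, rfl⟩

theorem IsStoppedGeodesic.exists_isGeneralizedRay (h : IsStoppedGeodesic R c) (h0 : c 0 = o) :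
    ∃ ξ, IsGeneralizedRay dist o c ξ := by
  induction R with
  | top => exact ⟨_, h.isGeneralizedRay_top h0⟩
  | coe r => exact ⟨_, h.isGeneralizedRay_coe h0⟩

theorem IsGeneralizedRay.cases {ξ : GromovCompactification (dist : X → X → ℝ)}
    (h : IsGeneralizedRay dist o c ξ) : c 0 = o ∧
      ((∃ r : ℝ≥0, IsStoppedGeodesic r c ∧ ξ = .of (c r)) ∨
        ∃ h : IsStoppedGeodesic ⊤ c, ξ = .bdry (Quot.mk _ h.ray)) := by
  cases ξ with
  | of x =>
    obtain ⟨h0, r, h1, h2⟩ := h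
    have hx : c r = x := h2 r le_rfl
    exact ⟨h0, .inl ⟨r, isStoppedGeodesic_coe h1 fun t ht => by rw [h2 t ht, hx], by rw [hx]⟩⟩
  | bdry σ =>
    obtain ⟨h0, γ, rfl, rfl⟩ := h
    exact ⟨h0, .inr ⟨γ.isStoppedGeodesic, rfl⟩⟩

theorem IsGeneralizedRay.exists_isStoppedGeodesic {ξ : GromovCompactification (dist : X → X → ℝ)}
    (h : IsGeneralizedRay dist o c ξ) : ∃ R, IsStoppedGeodesic R c := by
  rcases h.cases.2 with ⟨r, hr, -⟩ | ⟨h, -⟩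
  exacts [⟨_, hr⟩, ⟨_, h⟩]

theorem ConvergesLocallyUniformly.tendsto {c : ℕ → ℝ≥0 → X}
    (h : ConvergesLocallyUniformly dist c c') (t : ℝ≥0) :
    Tendsto (fun n => c n t) atTop (𝓝 (c' t)) :=
  Metric.tendsto_atTop.2 fun ε hε => (h t ε hε).imp fun _ hN n hn => hN n hn t le_rfl

theorem tendsto_toReal_min {R : ℕ → ℝ≥0∞} {R' : ℝ≥0∞} (h : Tendsto R atTop (𝓝 R')) (s : ℝ≥0) :
    Tendsto (fun n => (min (s : ℝ≥0∞) (R n)).toReal) atTop (𝓝 (min (s : ℝ≥0∞) R').toReal) :=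
  (ENNReal.tendsto_toReal (ne_top_of_le_ne_top ENNReal.coe_ne_top (min_le_left _ _))).comp
    (tendsto_const_nhds.min h)

theorem isStoppedGeodesic_of_tendsto {R : ℕ → ℝ≥0∞} {R' : ℝ≥0∞} {c : ℕ → ℝ≥0 → X}
    (h : ∀ n, IsStoppedGeodesic (R n) (c n)) (hR : Tendsto R atTop (𝓝 R'))
    (hc : ∀ t, Tendsto (fun n => c n t) atTop (𝓝 (c' t))) : IsStoppedGeodesic R' c' := by
  intro s t
  refine tendsto_nhds_unique (((hc s).dist (hc t)).congr fun n => h n s t) ?_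
  exact ((tendsto_toReal_min hR s).sub (tendsto_toReal_min hR t)).abs

/-- Stopping times in the compact space `[0, ∞]` put segments and rays into one family that is
closed under limits; Arzelà–Ascoli does the rest. -/
theorem exists_subseq_isStoppedGeodesic [ProperSpace X] {R : ℕ → ℝ≥0∞} {c : ℕ → ℝ≥0 → X}
    (h : ∀ n, IsStoppedGeodesic (R n) (c n)) (h0 : ∀ n, c n 0 = o) :
    ∃ φ : ℕ → ℕ, StrictMono φ ∧ ∃ (R' : ℝ≥0∞) (c' : ℝ≥0 → X), Tendsto (R ∘ φ) atTop (𝓝 R') ∧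
      IsStoppedGeodesic R' c' ∧ c' 0 = o ∧
      ConvergesLocallyUniformly dist (fun n => c (φ n)) c' := by
  obtain ⟨R', -, φ, hφ, hR'⟩ := isCompact_univ.tendsto_subseq fun n => mem_univ (R n)
  obtain ⟨ψ, hψ, c', -, hc'⟩ := exists_subseq_tendsto_of_lipschitz
    (c := fun n => c (φ n)) (fun n => (h _).lipschitzWith) 0 o 0 fun n => by simp [h0]
  have hconv : ConvergesLocallyUniformly dist (fun n => c (φ (ψ n))) c' := fun r ε hε => by
    obtain ⟨N, hN⟩ := hc' r ε hε
    exact ⟨N, fun n hn t ht => hN n hn t (by simpa [NNReal.dist_eq] using ht)⟩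
  have hR'' : Tendsto (fun n => R (φ (ψ n))) atTop (𝓝 R') := hR'.comp hψ.tendsto_atTop
  refine ⟨φ ∘ ψ, hφ.comp hψ, R', c', hR'',
    isStoppedGeodesic_of_tendsto (fun n => h _) hR'' hconv.tendsto, ?_, hconv⟩
  refine tendsto_nhds_unique (hconv.tendsto 0) ?_
  simp [h0]

/-- A locally uniformly convergent sequence of generalized rays converges to the end point of its
limit. -/
theorem ConvergesLocallyUniformly.gromovConverges {c : ℕ → ℝ≥0 → X}
    {u : ℕ → GromovCompactification (dist : X → X → ℝ)}
    {ξ : GromovCompactification (dist : X → X → ℝ)}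
    (h : ConvergesLocallyUniformly dist c c') (hu : ∀ n, IsGeneralizedRay dist o (c n) (u n))
    (hξ : IsGeneralizedRay dist o c' ξ) : GromovConverges dist u ξ := by
  refine ⟨o, c, hu, fun φ hφ => ⟨id, strictMono_id, c', hξ, fun r ε hε => ?_⟩⟩
  obtain ⟨N, hN⟩ := h r ε hε
  exact ⟨N, fun n hn => hN _ (hn.trans (hφ.id_le n))⟩

theorem isClosed_gromovCompactification_iff {B : Set (GromovCompactification (dist : X → X → ℝ))} :
    IsClosed B ↔ ∀ u ξ, (∀ n : ℕ, u n ∈ B) → GromovConverges dist u ξ → ξ ∈ B := by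
  rw [← isOpen_compl_iff]
  change Bᶜᶜ ∈ {B : Set (GromovCompactification (dist : X → X → ℝ)) |
    ∀ u ξ, (∀ n : ℕ, u n ∈ B) → GromovConverges dist u ξ → ξ ∈ B} ↔ _
  rw [compl_compl]
  rfl

/-- A subsequence outside an open neighbourhood of `ξ` would still converge to `ξ` in the Gromov
sense, against the closedness of the complement. -/
theorem GromovConverges.tendsto {u : ℕ → GromovCompactification (dist : X → X → ℝ)}
    {ξ : GromovCompactification (dist : X → X → ℝ)} (h : GromovConverges dist u ξ) :
    Tendsto u atTop (𝓝 ξ) := by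
  rw [tendsto_nhds]
  intro O hO hξ
  by_contra hn
  obtain ⟨φ, hφ, hφO⟩ := extraction_of_frequently_atTop (not_eventually.1 hn)
  exact isClosed_gromovCompactification_iff.1 hO.isClosed_compl _ ξ hφO (h.subseq hφ) hξ

end Geodesic

/-! ## Visibility and extensions of the identity to the Gromov compactification -/

section Visibility

open scoped ENNReal

variable {X Y : Type*} [MetricSpace X] [MetricSpace Y] {ι : X → Y}

/-- Visibility of `X` in a compactification `ι : X → Y`: the geodesics that join points close to
two distinct boundary points meet a compact set. -/
def IsVisibilityCompactification (ι : X → Y) : Prop :=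
  ∀ p ∉ range ι, ∀ q ∉ range ι, p ≠ q → ∃ U ∈ 𝓝 p, ∃ V ∈ 𝓝 q, ∃ K : Set X, IsCompact K ∧
    ∀ (a b : ℝ) (γ : ℝ → X), a ≤ b → IsGeodesicOn dist (Icc a b) γ → ι (γ a) ∈ U → ι (γ b) ∈ V →
      (γ '' Icc a b ∩ K).Nonempty

theorem tendsto_dist_atTop_of_notMem_range [ProperSpace X] (hι : Continuous ι) {α : Type*}
    {l : Filter α} {x : α → X} {q : Y} (h : Tendsto (fun a => ι (x a)) l (𝓝 q))
    (hq : q ∉ range ι) (o : X) : Tendsto (fun a => dist o (x a)) l atTop := by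
  refine tendsto_atTop.2 fun b => ?_
  have hK : IsClosed (ι '' Metric.closedBall o b) :=
    ((isCompact_closedBall o b).image hι).isClosed
  have hqK : q ∈ (ι '' Metric.closedBall o b)ᶜ := fun hq' => hq (image_subset_range _ _ hq')
  filter_upwards [h.eventually (hK.isOpen_compl.mem_nhds hqK)] with a ha
  by_contra! hlt
  exact ha ⟨_, Metric.mem_closedBall'.2 hlt.le, rfl⟩

theorem notMem_range_of_tendsto_dist_atTop (hι : IsEmbedding ι) {α : Type*}
    {l : Filter α} [l.NeBot] {x : α → X} {q : Y} (h : Tendsto (fun a => ι (x a)) l (𝓝 q)) {o : X}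
    (ho : Tendsto (fun a => dist o (x a)) l atTop) : q ∉ range ι := by
  rintro ⟨y, rfl⟩
  exact not_tendsto_nhds_of_tendsto_atTop ho _
    (tendsto_const_nhds.dist (hι.tendsto_nhds_iff.2 h))

theorem IsStoppedGeodesic.tendsto_dist {c : ℝ≥0 → X} (h : IsStoppedGeodesic ⊤ c) :
    Tendsto (fun t => dist (c 0) (c t)) atTop atTop := by
  simp only [h.dist_zero le_top]
  exact NNReal.tendsto_coe_atTop.2 tendsto_id

/-- In a visible compactification, the end points of long geodesics that converge to a ray converge
to the limit points of the ray. -/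
theorem IsVisibilityCompactification.eq_of_tendsto [ProperSpace X]
    (hV : IsVisibilityCompactification ι) (hι : IsEmbedding ι)
    {R : ℕ → ℝ≥0∞} {c : ℕ → ℝ≥0 → X} {c' : ℝ≥0 → X} (hc : ∀ n, IsStoppedGeodesic (R n) (c n))
    (hc' : IsStoppedGeodesic ⊤ c') (hconv : ∀ t, Tendsto (fun n => c n t) atTop (𝓝 (c' t)))
    {t : ℕ → ℝ≥0} (htR : ∀ n, t n ≤ R n) (ht : Tendsto t atTop atTop) {p q : Y}
    (hp : MapClusterPt p atTop fun s => ι (c' s))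
    (hq : Tendsto (fun n => ι (c n (t n))) atTop (𝓝 q)) : p = q := by
  by_contra hpq
  have hp' : p ∉ range ι := by
    obtain ⟨ψ, hψ, hψ'⟩ := hp.exists_seq_tendsto
    exact notMem_range_of_tendsto_dist_atTop hι hψ (hc'.tendsto_dist.comp hψ')
  have hq' : q ∉ range ι := by
    refine notMem_range_of_tendsto_dist_atTop hι hq (o := c' 0) ?_
    have h1 : Tendsto (fun n => (t n : ℝ)) atTop atTop := NNReal.tendsto_coe_atTop.2 ht
    refine tendsto_atTop_mono' _ ?_ (tendsto_atTop_add_const_right _ (-1 : ℝ) h1)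
    filter_upwards [Metric.tendsto_nhds.1 (hconv 0) 1 one_pos] with n hn
    have h2 := (hc n).dist_zero (htR n)
    have h3 := dist_triangle (c n 0) (c' 0) (c n (t n))
    linarith
  obtain ⟨U, hU, V, hV', K, hK, h⟩ := hV p hp' q hq' hpq
  obtain ⟨r, hr⟩ := hK.isBounded.subset_closedBall (c' 0)
  -- `U` is required to be a neighbourhood of `ι (c' T)`, so that it also contains `ι (c n T)` for
  -- large `n`. The part of `c n` on `[T, t n]` is at distance at least `r + 2` from `c n 0`, hence
  -- more than `r` from `c' 0`, and so misses `K`.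
  obtain ⟨T, hTU, hT⟩ := ((hp.frequently (eventually_mem_nhds_iff.2 hU)).and_eventually
    (eventually_ge_atTop (r + 2).toNNReal)).exists
  have hT' : r + 2 ≤ T := Real.toNNReal_le_iff_le_coe.1 hT
  have e1 : ∀ᶠ n in atTop, ι (c n T) ∈ U :=
    ((hι.continuous.tendsto _).comp (hconv T)).eventually hTU
  obtain ⟨n, h1, h2, h3, h4⟩ := (e1.and ((hq.eventually hV').and
    ((ht.eventually_ge_atTop T).and (Metric.tendsto_nhds.1 (hconv 0) 1 one_pos)))).exists
  obtain ⟨z, ⟨s, hs, rfl⟩, hz⟩ := h T (t n) (fun s => c n s.toNNReal) (by exact_mod_cast h3)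
    ((hc n).isGeodesicOn T.2 (by simpa using htR n)) (by simpa using h1)
    (by rwa [Real.toNNReal_coe])
  have h5 := hr hz
  have hs0 : 0 ≤ s := T.2.trans hs.1
  have h6 : dist (c n 0) (c n s.toNNReal) = s := by
    rw [(hc n).dist_zero, Real.coe_toNNReal _ hs0]
    exact le_trans (ENNReal.coe_le_coe.2 (Real.toNNReal_le_iff_le_coe.2 hs.2)) (htR n)
  rw [Metric.mem_closedBall'] at h5
  have h7 := dist_triangle (c n 0) (c' 0) (c n s.toNNReal)
  linarith [hs.1]

/-- By compactness a unique cluster point suffices; uniqueness is `eq_of_tendsto` for the constant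
sequence `c`. -/
theorem IsVisibilityCompactification.exists_tendsto_ray [ProperSpace X] [CompactSpace Y]
    (hV : IsVisibilityCompactification ι)
    (hι : IsEmbedding ι) {c : ℝ≥0 → X} (hc : IsStoppedGeodesic ⊤ c) :
    ∃ p, Tendsto (fun t => ι (c t)) atTop (𝓝 p) := by
  obtain ⟨p, -, hp⟩ := isCompact_univ.exists_mapClusterPt (f := atTop)
    (u := fun t => ι (c t)) (by simp)
  refine ⟨p, isCompact_univ.tendsto_nhds_of_unique_mapClusterPt (by simp) fun q _ hq => ?_⟩
  obtain ⟨ψ, hψ, hψ'⟩ := hq.exists_seq_tendsto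
  exact (hV.eq_of_tendsto hι (fun _ => hc) hc (fun t => tendsto_const_nhds) (fun _ => le_top) hψ'
    hp hψ).symm

/-- Otherwise geodesics of length at most `C` from `γ t` to `η t` would have to reach a fixed
compact set as `γ t` goes to infinity. -/
theorem IsVisibilityCompactification.eq_of_asymptotic [ProperSpace X]
    (hV : IsVisibilityCompactification ι) (hι : IsEmbedding ι)
    (hX : IsGeodesicSpace X) {γ η : GeodesicRay (dist : X → X → ℝ)} (h : γ.Asymptotic η) {p q : Y}
    (hp : Tendsto (fun t => ι (γ.1 t)) atTop (𝓝 p))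
    (hq : Tendsto (fun t => ι (η.1 t)) atTop (𝓝 q)) : p = q := by
  by_contra hpq
  have hp' := notMem_range_of_tendsto_dist_atTop hι hp γ.isStoppedGeodesic.tendsto_dist
  have hq' := notMem_range_of_tendsto_dist_atTop hι hq η.isStoppedGeodesic.tendsto_dist
  obtain ⟨U, hU, V, hV', K, hK, hUVK⟩ := hV p hp' q hq' hpq
  obtain ⟨r, hr⟩ := hK.isBounded.subset_closedBall (γ.1 0)
  obtain ⟨C, hC⟩ := h
  obtain ⟨t, h1, h2, h3⟩ := ((hp.eventually hU).and ((hq.eventually hV').and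
    (γ.isStoppedGeodesic.tendsto_dist.eventually_gt_atTop (r + C)))).exists
  obtain ⟨g, hg, hg0, hg1⟩ := hX (γ.1 t) (η.1 t)
  obtain ⟨z, ⟨s, hs, rfl⟩, hz⟩ := hUVK 0 _ g dist_nonneg hg (by rwa [hg0]) (by rwa [hg1])
  have h4 := hg 0 ⟨le_rfl, dist_nonneg⟩ s hs
  rw [hg0, zero_sub, abs_neg, abs_of_nonneg hs.1] at h4
  have h5 := Metric.mem_closedBall'.1 (hr hz)
  have h6 := dist_triangle_right (γ.1 0) (γ.1 t) (g s)
  linarith [hs.2, hC t]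

/-- The limit map of a visible compactification is sequentially continuous along generalized
rays. -/
theorem IsVisibilityCompactification.eq_of_convergesLocallyUniformly [ProperSpace X]
    (hV : IsVisibilityCompactification ι)
    (hι : IsEmbedding ι) {Φ : GromovCompactification (dist : X → X → ℝ) → Y}
    (hΦ : ∀ x, Φ (.of x) = ι x)
    (hΦ' : ∀ γ : GeodesicRay (dist : X → X → ℝ),
      Tendsto (fun t => ι (γ.1 t)) atTop (𝓝 (Φ (.bdry (Quot.mk _ γ)))))
    {o : X} {c : ℕ → ℝ≥0 → X} {c' : ℝ≥0 → X} {u : ℕ → GromovCompactification (dist : X → X → ℝ)}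
    {ξ : GromovCompactification (dist : X → X → ℝ)}
    (hu : ∀ n, IsGeneralizedRay dist o (c n) (u n)) (hξ : IsGeneralizedRay dist o c' ξ)
    (hconv : ∀ t, Tendsto (fun n => c n t) atTop (𝓝 (c' t))) {q : Y}
    (hq : Tendsto (fun n => Φ (u n)) atTop (𝓝 q)) : Φ ξ = q := by
  have hdist : ∀ t, Tendsto (fun n => dist o (c n t)) atTop (𝓝 (dist o (c' t))) := fun t =>
    tendsto_const_nhds.dist (hconv t)
  obtain ⟨h0, ⟨r, hr, rfl⟩ | ⟨hc', rfl⟩⟩ := hξ.cases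
  -- The limit stops at time `r`. Since `dist o (c n (r + 1))` tends to `r < r + 1`, eventually `c
  -- n` has stopped before `r + 1`, and its end point is its value there.
  · have h1 : dist o (c' (r + 1)) = r := by
      rw [← h0, hr, min_eq_right (by simp : (r : ℝ≥0∞) ≤ (r + 1 : ℝ≥0))]
      simp
    have h2 : c' (r + 1) = c' r := by
      rw [← dist_eq_zero, hr, min_eq_right (by simp : (r : ℝ≥0∞) ≤ (r + 1 : ℝ≥0))]
      simp
    have h3 := hdist (r + 1)
    rw [h1] at h3
    have h4 : ∀ᶠ n in atTop, ι (c n (r + 1)) = Φ (u n) := by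
      filter_upwards [h3.eventually_lt_const (lt_add_one (r : ℝ))] with n hn
      have key : ∀ {R : ℝ≥0∞}, IsStoppedGeodesic R (c n) → R < (r + 1 : ℝ≥0) := fun {R} hR => by
        by_contra! hle
        rw [← (hu n).cases.1, hR.dist_zero hle] at hn
        simp at hn
      obtain ⟨h0', ⟨r', hr', he⟩ | ⟨hr', -⟩⟩ := (hu n).cases
      · rw [he, hΦ]
        congr 1
        rw [← dist_eq_zero, hr', min_eq_right (key hr').le]
        simp
      · exact absurd (key hr') (by simp)
    rw [hΦ, ← h2]
    exact tendsto_nhds_unique (((hι.continuous.tendsto _).comp (hconv _)).congr' h4) hq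
  -- The limit is a ray. Take `t n` to be the stopping time of a segment, or on a ray a time at
  -- least `n` at which it is within `1 / (n + 1)` of its limit; then `ι (c n (t n))` tends to `q`.
  · have hex : ∀ n, ∃ (R : ℝ≥0∞) (t : ℝ≥0), IsStoppedGeodesic R (c n) ∧ t ≤ R ∧
        (t = R ∨ (n : ℝ≥0) ≤ t) ∧ dist (Φ (u n)) (ι (c n t)) < 1 / ((n : ℝ) + 1) := fun n => by
      obtain ⟨h0', ⟨r', hr', he⟩ | ⟨hr', he⟩⟩ := (hu n).cases
      · exact ⟨r', r', hr', le_rfl, .inl rfl, by rw [he, hΦ, dist_self]; positivity⟩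
      · have h1 := hΦ' hr'.ray
        obtain ⟨t, ht, hnt⟩ := ((Metric.tendsto_nhds.1 h1 (1 / ((n : ℝ) + 1)) (by positivity)).and
          (eventually_ge_atTop (n : ℝ≥0))).exists
        refine ⟨⊤, t, hr', le_top, .inr hnt, ?_⟩
        rw [he, dist_comm]
        exact ht
    choose R t hR htR htn hdΦ using hex
    have ht : Tendsto t atTop atTop := by
      refine tendsto_atTop.2 fun b => ?_
      have h1 := hdist (b + 1)
      rw [← h0, hc'.dist_zero le_top, h0] at h1
      have h2 : (b : ℝ) < (b + 1 : ℝ≥0) := by simp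
      filter_upwards [h1.eventually_const_lt h2, eventually_ge_atTop ⌈b⌉₊] with n hn hbn
      rcases htn n with h | h
      · by_contra! hlt
        have hRb : R n ≤ (b + 1 : ℝ≥0) := by
          rw [← h]; exact_mod_cast (hlt.trans (lt_add_one b)).le
        rw [← (hu n).cases.1, hR n, min_eq_right hRb, ← h] at hn
        have h3 : (b : ℝ) < t n := by simpa using hn
        exact absurd (by exact_mod_cast h3) hlt.not_gt
      · exact (Nat.ceil_le.1 hbn).trans h
    refine hV.eq_of_tendsto hι hR hc' hconv htR ht (hΦ' hc'.ray).mapClusterPt ?_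
    refine tendsto_of_tendsto_of_dist hq ?_
    exact squeeze_zero (fun _ => dist_nonneg) (fun n => (hdΦ n).le)
      tendsto_one_div_add_atTop_nhds_zero_nat

/-- `Φ` sends a class of rays to their common limit. For surjectivity, approximate `q` by points of
`X`: the segments to them from a base point subconverge, and the end of the limit is mapped to `q`.
-/
theorem IsVisibilityCompactification.exists_extension [ProperSpace X] [CompactSpace Y]
    (hV : IsVisibilityCompactification ι)
    (hι : IsEmbedding ι) (hd : DenseRange ι) (hX : IsGeodesicSpace X) :
    ∃ Φ : GromovCompactification (dist : X → X → ℝ) → Y,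
      Continuous Φ ∧ Function.Surjective Φ ∧ ∀ x, Φ (.of x) = ι x := by
  choose L hL using fun γ : GeodesicRay (dist : X → X → ℝ) =>
    hV.exists_tendsto_ray hι γ.isStoppedGeodesic
  set Φ : GromovCompactification (dist : X → X → ℝ) → Y := fun ξ =>
    match ξ with
    | .of x => ι x
    | .bdry σ => Quot.lift L (fun γ η h => hV.eq_of_asymptotic hι hX h (hL γ) (hL η)) σ with hΦdef
  have hΦ : ∀ x, Φ (.of x) = ι x := fun _ => rfl
  have hΦ' : ∀ γ : GeodesicRay (dist : X → X → ℝ),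
      Tendsto (fun t => ι (γ.1 t)) atTop (𝓝 (Φ (.bdry (Quot.mk _ γ)))) := hL
  refine ⟨Φ, continuous_iff_isClosed.2 fun B hB => ?_, fun q => ?_, hΦ⟩
  · refine isClosed_gromovCompactification_iff.2 fun u ξ hu ⟨o, c, hc, hs⟩ => ?_
    obtain ⟨ψ, hψ, c', hc', hconv⟩ := hs id strictMono_id
    obtain ⟨q, -, θ, hθ, hq⟩ := isCompact_univ.tendsto_subseq fun n => mem_univ (Φ (u (ψ n)))
    have := hV.eq_of_convergesLocallyUniformly hι hΦ hΦ' (fun n => hc (ψ (θ n))) hc'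
      (fun t => (hconv.tendsto t).comp hθ.tendsto_atTop) hq
    rw [mem_preimage, this]
    exact hB.mem_of_tendsto hq (Eventually.of_forall fun n => hu _)
  · obtain ⟨x, hx, hxq⟩ := mem_closure_iff_seq_limit.1 (hd q)
    choose y hy using hx
    have hXne : Nonempty X := ⟨y 0⟩
    obtain ⟨o⟩ := hXne
    choose c hc hc0 hc1 using fun n => hX.exists_isStoppedGeodesic o (y n)
    obtain ⟨φ, hφ, R', c', -, hc', hc'0, hconv⟩ := exists_subseq_isStoppedGeodesic hc hc0
    obtain ⟨ξ, hξ⟩ := hc'.exists_isGeneralizedRay hc'0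
    refine ⟨ξ, hV.eq_of_convergesLocallyUniformly hι hΦ hΦ'
      (fun n => (hc (φ n)).isGeneralizedRay_coe (hc0 _)) hξ hconv.tendsto ?_⟩
    simp only [hΦ, hc1, hy]
    exact hxq.comp hφ.tendsto_atTop

end Visibility

/-! ## Gromov hyperbolic spaces -/

section Hyperbolic

open scoped ENNReal

variable {X Y : Type*} [MetricSpace X] [MetricSpace Y] {ι : X → Y}

theorem IsGeodesicSegment.symm {x y : X} {A : Set X} (h : IsGeodesicSegment dist x y A) :
    IsGeodesicSegment dist y x A := by
  obtain ⟨L, γ, hL, hγ, rfl, rfl, rfl⟩ := h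
  refine ⟨L, fun t => γ (L - t), hL, fun s hs t ht => ?_, by simp, by simp, ?_⟩
  · rw [hγ _ ⟨by linarith [hs.2], by linarith [hs.1]⟩ _ ⟨by linarith [ht.2], by linarith [ht.1]⟩,
      abs_sub_comm]
    congr 1; ring
  · rw [← image_image γ (fun t => L - t)]
    simp

theorem isGeodesicSegment_of_isGeodesicOn {γ : ℝ → X} {a b : ℝ} (hab : a ≤ b)
    (h : IsGeodesicOn dist (Icc a b) γ) : IsGeodesicSegment dist (γ a) (γ b) (γ '' Icc a b) := by
  refine ⟨b - a, fun t => γ (a + t), sub_nonneg.2 hab, fun s hs t ht => ?_, by simp, by simp, ?_⟩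
  · rw [h _ ⟨by linarith [hs.1], by linarith [hs.2]⟩ _ ⟨by linarith [ht.1], by linarith [ht.2]⟩]
    congr 1; ring
  · rw [← image_image γ (fun t => a + t)]
    simp

theorem isGeodesicSegment_of_nnreal {c : ℝ≥0 → X} {a : ℝ≥0}
    (h : ∀ s ≤ a, ∀ t ≤ a, dist (c s) (c t) = |(s : ℝ) - t|) :
    IsGeodesicSegment dist (c 0) (c a) (c '' Icc 0 a) := by
  refine ⟨a, fun t => c t.toNNReal, a.2, fun s hs t ht => ?_, by simp, by simp, ?_⟩
  · rw [h _ (Real.toNNReal_le_iff_le_coe.2 hs.2) _ (Real.toNNReal_le_iff_le_coe.2 ht.2),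
      Real.coe_toNNReal _ hs.1, Real.coe_toNNReal _ ht.1]
  · ext x
    constructor
    · rintro ⟨s, hs, rfl⟩
      exact ⟨s, ⟨s.2, by exact_mod_cast hs.2⟩, by simp⟩
    · rintro ⟨s, hs, rfl⟩
      exact ⟨_, ⟨zero_le, Real.toNNReal_le_iff_le_coe.2 hs.2⟩, rfl⟩

theorem IsGeodesicSpace.exists_isGeodesicSegment (h : IsGeodesicSpace X) (x y : X) :
    ∃ A, IsGeodesicSegment dist x y A := by
  obtain ⟨γ, hγ, h0, h1⟩ := h x y
  exact ⟨_, _, γ, dist_nonneg, hγ, h0, h1, rfl⟩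

theorem IsGeodesicSegment.dist_le {x y z : X} {A : Set X} (h : IsGeodesicSegment dist x y A)
    (hz : z ∈ A) : dist x z ≤ dist x y := by
  obtain ⟨L, γ, hL, hγ, rfl, rfl, rfl⟩ := h
  obtain ⟨s, hs, rfl⟩ := hz
  rw [hγ 0 ⟨le_rfl, hL⟩ s hs, hγ 0 ⟨le_rfl, hL⟩ L ⟨hL, le_rfl⟩, zero_sub, zero_sub, abs_neg,
    abs_neg, abs_of_nonneg hs.1, abs_of_nonneg hL]
  exact hs.2

/-- Geodesic triangles are `δ`-slim. -/
def IsSlim (X : Type*) [MetricSpace X] (δ : ℝ) : Prop :=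
  ∀ (x y z : X) (A B C : Set X), IsGeodesicSegment dist x y A →
    IsGeodesicSegment dist y z B → IsGeodesicSegment dist z x C →
    ∀ p ∈ A, ∃ q ∈ B ∪ C, dist p q < δ

variable {δ : ℝ}

/-- Two geodesics from the same point are close to one another as long as the third side of the
triangle is far away. -/
theorem IsSlim.dist_le_of_forall_le_dist (h : IsSlim X δ) {c c' : ℝ≥0 → X} {a b : ℝ≥0}
    (hc : ∀ s ≤ a, ∀ t ≤ a, dist (c s) (c t) = |(s : ℝ) - t|)
    (hc' : ∀ s ≤ b, ∀ t ≤ b, dist (c' s) (c' t) = |(s : ℝ) - t|) (h0 : c 0 = c' 0) {B : Set X}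
    (hB : IsGeodesicSegment dist (c a) (c' b) B) {N : ℝ} (hBN : ∀ q ∈ B, N ≤ dist (c 0) q)
    {t : ℝ≥0} (hta : t ≤ a) (htb : t ≤ b) (htN : t + δ ≤ N) : dist (c t) (c' t) ≤ 2 * δ := by
  have hC := (isGeodesicSegment_of_nnreal hc').symm
  rw [← h0] at hC
  -- `c t` is not `δ`-close to the third side, as that would give `N < t + δ`. If it is close to `c'
  -- s`, comparing distances to the common origin gives `|s - t| ≤ δ`.
  obtain ⟨q, hq | ⟨s, hs, rfl⟩, hqδ⟩ := h _ _ _ _ _ _ (isGeodesicSegment_of_nnreal hc) hB hC (c t)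
    ⟨t, ⟨zero_le, hta⟩, rfl⟩
  · have h1 := hBN q hq
    have h2 := hc 0 zero_le t hta
    rw [NNReal.coe_zero, zero_sub, abs_neg, NNReal.abs_eq] at h2
    have h3 := dist_triangle (c 0) (c t) q
    linarith
  · have h1 := hc 0 zero_le t hta
    have h2 := hc' 0 zero_le s hs.2
    rw [NNReal.coe_zero, zero_sub, abs_neg, NNReal.abs_eq] at h1
    rw [NNReal.coe_zero, zero_sub, abs_neg, NNReal.abs_eq, ← h0] at h2
    have h3 := hc' s hs.2 t htb
    have h4 : |(s : ℝ) - t| ≤ δ := by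
      have e1 := dist_triangle (c 0) (c t) (c' s)
      have e2 := dist_triangle_right (c 0) (c t) (c' s)
      rw [abs_le]
      constructor <;> linarith
    have h5 := dist_triangle (c t) (c' s) (c' t)
    linarith

/-- Two geodesics to the same point fellow-travel. -/
theorem IsSlim.dist_le_of_eq (h : IsSlim X δ) (hX : IsGeodesicSpace X) {c c' : ℝ≥0 → X} {a b : ℝ≥0}
    (hc : ∀ s ≤ a, ∀ t ≤ a, dist (c s) (c t) = |(s : ℝ) - t|)
    (hc' : ∀ s ≤ b, ∀ t ≤ b, dist (c' s) (c' t) = |(s : ℝ) - t|) (hab : c a = c' b)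
    {t : ℝ≥0} (hta : t ≤ a) (htb : t ≤ b) :
    dist (c t) (c' t) ≤ 2 * δ + 3 * dist (c 0) (c' 0) := by
  obtain ⟨C, hC⟩ := hX.exists_isGeodesicSegment (c 0) (c' 0)
  have hB := (isGeodesicSegment_of_nnreal hc').symm
  rw [← hab] at hB
  have h1 := hc 0 zero_le t hta
  have h1' := hc' 0 zero_le t htb
  rw [NNReal.coe_zero, zero_sub, abs_neg, NNReal.abs_eq] at h1 h1'
  -- Let `D = dist (c 0) (c' 0)`. In the first case `|s - t| ≤ δ + D`, in total `2δ + D`. In the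
  -- second `t < δ + D`, and the path through `c 0` and `c' 0` has length `2t + D`, whence `2δ +
  -- 3D`.
  obtain ⟨q, ⟨s, hs, rfl⟩ | hq, hqδ⟩ := h _ _ _ _ _ _ (isGeodesicSegment_of_nnreal hc) hB hC.symm
    (c t) ⟨t, ⟨zero_le, hta⟩, rfl⟩
  · have h2 := hc' 0 zero_le s hs.2
    rw [NNReal.coe_zero, zero_sub, abs_neg, NNReal.abs_eq] at h2
    have h3 := hc' s hs.2 t htb
    have h4 : |(s : ℝ) - t| ≤ δ + dist (c 0) (c' 0) := by
      rw [abs_le]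
      have e1 := dist_triangle4 (c 0) (c' 0) (c' s) (c t)
      have e2 := dist_triangle4 (c' 0) (c 0) (c t) (c' s)
      rw [dist_comm (c' s)] at e1
      rw [dist_comm (c' 0) (c 0)] at e2
      constructor <;> linarith
    have h5 := dist_triangle (c t) (c' s) (c' t)
    linarith [dist_nonneg (x := c 0) (y := c' 0)]
  · have h2 := hC.dist_le hq
    have h3 := dist_triangle_right (c 0) (c t) q
    have h4 := dist_triangle4 (c t) (c 0) (c' 0) (c' t)
    rw [dist_comm (c t) (c 0)] at h4
    linarith

theorem GeodesicRay.asymptotic_equivalence :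
    Equivalence (GeodesicRay.Asymptotic (dist := (dist : X → X → ℝ))) where
  refl γ := ⟨0, fun t => by simp⟩
  symm := fun ⟨C, hC⟩ => ⟨C, fun t => by rw [dist_comm]; exact hC t⟩
  trans := fun ⟨C, hC⟩ ⟨D, hD⟩ =>
    ⟨C + D, fun t => (dist_triangle _ _ _).trans (add_le_add (hC t) (hD t))⟩

theorem GeodesicRay.mk_eq_mk_iff {γ η : GeodesicRay (dist : X → X → ℝ)} :
    (Quot.mk _ γ : GromovBoundary (dist : X → X → ℝ)) = Quot.mk _ η ↔ γ.Asymptotic η :=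
  ⟨fun h => asymptotic_equivalence.eqvGen_iff.1 (Quot.eqvGen_exact h), Quot.sound⟩

theorem GeodesicRay.dist_eq_of_le (γ : GeodesicRay (dist : X → X → ℝ)) (a : ℝ≥0) :
    ∀ s ≤ a, ∀ t ≤ a, dist (γ.1 s) (γ.1 t) = |(s : ℝ) - t| := fun s _ t _ => γ.2 s t

/-- Every point of the Gromov compactification is the end point of a generalized ray from a given
base point. -/
theorem IsSlim.exists_isGeneralizedRay [ProperSpace X] (h : IsSlim X δ) (hX : IsGeodesicSpace X)
    (o : X) (ξ : GromovCompactification (dist : X → X → ℝ)) :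
    ∃ c, IsGeneralizedRay dist o c ξ := by
  cases ξ with
  | of x =>
    obtain ⟨c, hc, h0, h1⟩ := hX.exists_isStoppedGeodesic o x
    refine ⟨c, ?_⟩
    rw [← h1]
    exact hc.isGeneralizedRay_coe h0
  | bdry σ =>
    obtain ⟨η, rfl⟩ := Quot.exists_rep σ
    choose c hc hc0 hc1 using fun n : ℕ => hX.exists_isStoppedGeodesic o (η.1 n)
    obtain ⟨φ, hφ, R', c', hR', hc', hc'0, hconv⟩ := exists_subseq_isStoppedGeodesic hc hc0
    have hlim : Tendsto (fun n : ℕ => nndist o (η.1 n)) atTop atTop := by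
      have h1 : Tendsto (fun n : ℕ => dist (η.1 0) (η.1 n)) atTop atTop :=
        η.isStoppedGeodesic.tendsto_dist.comp tendsto_natCast_atTop_atTop
      rw [← NNReal.tendsto_coe_atTop]
      refine tendsto_atTop_mono (fun n => ?_) (tendsto_atTop_add_const_right _ (-dist o (η.1 0)) h1)
      have := dist_triangle_left (η.1 0) (η.1 n) o
      rw [coe_nndist]
      linarith
    -- The segments from `o` to `η n` become infinitely long, so their limit is a ray; it is
    -- asymptotic to `η` because fellow-travelling bounds pass to the limit.
    obtain rfl : R' = ⊤ := tendsto_nhds_unique hR'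
      ((ENNReal.tendsto_coe_nhds_top.2 hlim).comp hφ.tendsto_atTop)
    refine ⟨c', hc'0, hc'.ray, rfl, GeodesicRay.mk_eq_mk_iff.2
      ⟨2 * δ + 3 * dist o (η.1 0), fun t => ?_⟩⟩
    refine le_of_tendsto ((hconv.tendsto t).dist tendsto_const_nhds) ?_
    filter_upwards [(hlim.comp hφ.tendsto_atTop).eventually_ge_atTop t,
      (tendsto_natCast_atTop_atTop (R := ℝ≥0).comp hφ.tendsto_atTop).eventually_ge_atTop t]
      with n hn hn'
    have := h.dist_le_of_eq hX (c := c (φ n)) (c' := η.1) (a := nndist o (η.1 (φ n))) (b := φ n)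
      (fun s hs t ht => (hc _).dist_eq (by exact_mod_cast hs) (by exact_mod_cast ht))
      (η.dist_eq_of_le _) (hc1 _) (t := t) hn hn'
    rwa [hc0] at this

/-- Two geodesic rays from the same point that are not asymptotic are asymptotic to the two ends
of a geodesic line. -/
theorem IsSlim.exists_line [ProperSpace X] (h : IsSlim X δ) (hX : IsGeodesicSpace X)
    {γ η : GeodesicRay (dist : X → X → ℝ)} (h0 : γ.1 0 = η.1 0) (hne : ¬ γ.Asymptotic η) :
    ∃ g : ℝ → X, IsGeodesicOn dist univ g ∧ ∃ C : ℝ, ∀ t : ℝ≥0,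
      dist (g (-t)) (γ.1 t) ≤ C ∧ dist (g t) (η.1 t) ≤ C := by
  choose g hg hg0 hg1 using fun n : ℕ => hX (γ.1 n) (η.1 n)
  set L : ℕ → ℝ := fun n => dist (γ.1 n) (η.1 n) with hL
  have hL0 : ∀ n, 0 ≤ L n := fun n => dist_nonneg
  set o := γ.1 0 with ho
  -- If the sides from `γ n` to `η n` did not stay within bounded distance of `o`, slimness would
  -- keep `γ` and `η` within `2δ`.
  have hN : ∃ N : ℕ, ∀ n ≥ N, ∃ s ∈ Icc 0 (L n), dist o (g n s) < N := by
    by_contra! hcon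
    refine hne ⟨2 * δ, fun t => ?_⟩
    obtain ⟨N, hN⟩ := exists_nat_ge (max (t + δ) t)
    obtain ⟨n, hn, hns⟩ := hcon N
    have htn : t ≤ n := by
      have h1 : (t : ℝ) ≤ N := (le_max_right _ _).trans hN
      have h2 : (N : ℝ) ≤ n := by exact_mod_cast hn
      exact_mod_cast h1.trans h2
    have hseg := isGeodesicSegment_of_isGeodesicOn (hL0 n) (hg n)
    rw [hg0, hg1] at hseg
    exact h.dist_le_of_forall_le_dist (γ.dist_eq_of_le n) (η.dist_eq_of_le n) h0 hseg (N := N)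
      (by rintro _ ⟨s, hs, rfl⟩; exact hns s hs) htn htn ((le_max_left _ _).trans hN)
  obtain ⟨N, hN⟩ := hN
  choose s hs hsN using fun n : ℕ => hN (N + n) (Nat.le_add_right _ _)
  -- The sides are shifted so that time `0` is near `o`; `projIcc` freezes them beyond their ends,
  -- giving `1`-Lipschitz maps on all of `ℝ`.
  set c : ℕ → ℝ → X := fun n t =>
    g (N + n) (projIcc 0 (L (N + n)) (hL0 _) (s n + t)) with hc
  have hclip : ∀ n, LipschitzWith 1 (c n) := fun n => by
    refine LipschitzWith.of_dist_le_mul fun u v => ?_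
    rw [hc]
    simp only
    rw [hg _ _ (Subtype.coe_prop _) _ (Subtype.coe_prop _)]
    refine ((LipschitzWith.projIcc (hL0 (N + n))).dist_le_mul (s n + u) (s n + v)).trans ?_
    simp
  have hcg : ∀ n, ∀ t ∈ Icc (-s n) (L (N + n) - s n), c n t = g (N + n) (s n + t) :=
    fun n t ht => by
      simp only [hc]
      rw [projIcc_of_mem (hL0 _) ⟨by linarith [ht.1], by linarith [ht.2]⟩]
  have hcgeo : ∀ n, IsGeodesicOn dist (Icc (-s n) (L (N + n) - s n)) (c n) :=
    fun n u hu v hv => by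
      rw [hcg n u hu, hcg n v hv, hg _ _ ⟨by linarith [hu.1], by linarith [hu.2]⟩ _
        ⟨by linarith [hv.1], by linarith [hv.2]⟩]
      congr 1; ring
  -- The ends are at distance `N + n` from `o` and the marked point is within `N`, so both halves
  -- have length at least `n` and the limit is a full line.
  have hs1 : ∀ n : ℕ, (n : ℝ) ≤ s n := fun n => by
    have h1 := hg (N + n) 0 ⟨le_rfl, hL0 _⟩ (s n) (hs n)
    rw [hg0, zero_sub, abs_neg, abs_of_nonneg (hs n).1] at h1
    have h2 := γ.isStoppedGeodesic.dist_zero (t := ((N + n : ℕ) : ℝ≥0)) le_top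
    have h3 := dist_triangle_right (γ.1 0) (γ.1 ((N + n : ℕ) : ℝ≥0)) (g (N + n) (s n))
    have h4 := hsN n
    push_cast at h1 h2 h3
    linarith
  have hs2 : ∀ n : ℕ, (n : ℝ) ≤ L (N + n) - s n := fun n => by
    have h1 := hg (N + n) _ ⟨hL0 _, le_rfl⟩ (s n) (hs n)
    rw [hg1, abs_of_nonneg (sub_nonneg.2 (hs n).2)] at h1
    have h2 := η.isStoppedGeodesic.dist_zero (t := ((N + n : ℕ) : ℝ≥0)) le_top
    have h3 := dist_triangle_right (η.1 0) (η.1 ((N + n : ℕ) : ℝ≥0)) (g (N + n) (s n))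
    have h4 := hsN n
    rw [h0] at h4
    have h5 : (((N + n : ℕ) : ℝ≥0) : ℝ) = N + n := by push_cast; ring
    linarith
  have hc0 : ∀ n, dist (c n 0) o ≤ N := fun n => by
    rw [hcg n 0 ⟨by linarith [(hs n).1], by linarith [(hs n).2]⟩, add_zero, dist_comm]
    exact (hsN n).le
  obtain ⟨φ, hφ, c', -, hc'⟩ := exists_subseq_tendsto_of_lipschitz hclip 0 o N hc0
  have hlim : ∀ t, Tendsto (fun n => c (φ n) t) atTop (𝓝 (c' t)) := fun t =>
    Metric.tendsto_atTop.2 fun ε hε => (hc' |t| ε hε).imp fun _ hN n hn =>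
      hN n hn t (by simp)
  have hφn : ∀ t : ℝ, ∀ᶠ n in atTop, t ≤ φ n := fun t =>
    ((tendsto_natCast_atTop_atTop (R := ℝ)).comp hφ.tendsto_atTop).eventually_ge_atTop t
  refine ⟨c', fun u _ v _ => ?_, 2 * δ + 3 * N, fun t => ⟨?_, ?_⟩⟩
  · refine tendsto_nhds_unique ((hlim u).dist (hlim v)) (tendsto_const_nhds.congr' ?_)
    filter_upwards [hφn |u|, hφn |v|] with n hu hv
    have h1 := hs1 (φ n)
    have h2 := hs2 (φ n)
    rw [abs_le] at hu hv
    exact (hcgeo (φ n) u ⟨by linarith, by linarith⟩ v ⟨by linarith, by linarith⟩).symm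
  · refine le_of_tendsto ((hlim _).dist tendsto_const_nhds) ?_
    filter_upwards [hφn t] with n hn
    have h1 := hs1 (φ n)
    have h2 := hs2 (φ n)
    have hs0 : 0 ≤ s (φ n) := (hs (φ n)).1
    have := h.dist_le_of_eq hX (c := fun t : ℝ≥0 => c (φ n) (-t)) (c' := γ.1)
      (a := ⟨s (φ n), hs0⟩) (b := ((N + φ n : ℕ) : ℝ≥0)) (fun u hu v hv => ?_)
      (γ.dist_eq_of_le _) ?_ (t := t) (NNReal.coe_le_coe.1 (hn.trans h1)) ?_
    · refine this.trans ?_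
      have := hc0 (φ n)
      simp only [NNReal.coe_zero, neg_zero]
      linarith
    · have hu' : (u : ℝ) ≤ s (φ n) := hu
      have hv' : (v : ℝ) ≤ s (φ n) := hv
      have hu0 : (0 : ℝ) ≤ u := u.2
      have hv0 : (0 : ℝ) ≤ v := v.2
      have hn0 : (0 : ℝ) ≤ φ n := Nat.cast_nonneg _
      rw [hcgeo (φ n) _ ⟨by linarith, by linarith⟩ _ ⟨by linarith, by linarith⟩, abs_sub_comm]
      congr 1; ring
    · have hn0 : (0 : ℝ) ≤ φ n := Nat.cast_nonneg _
      change c (φ n) (-s (φ n)) = _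
      rw [hcg _ _ ⟨le_rfl, by linarith⟩, add_neg_cancel, hg0]
    · rw [← NNReal.coe_le_coe]
      push_cast
      have : (0 : ℝ) ≤ N := Nat.cast_nonneg _
      linarith
  · refine le_of_tendsto ((hlim _).dist tendsto_const_nhds) ?_
    filter_upwards [hφn t] with n hn
    have h1 := hs1 (φ n)
    have h2 := hs2 (φ n)
    have hs0 : 0 ≤ L (N + φ n) - s (φ n) := sub_nonneg.2 (hs (φ n)).2
    have := h.dist_le_of_eq hX (c := fun t : ℝ≥0 => c (φ n) t) (c' := η.1)
      (a := ⟨L (N + φ n) - s (φ n), hs0⟩) (b := ((N + φ n : ℕ) : ℝ≥0)) (fun u hu v hv => ?_)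
      (η.dist_eq_of_le _) ?_ (t := t) (NNReal.coe_le_coe.1 (hn.trans h2)) ?_
    · refine this.trans ?_
      have := hc0 (φ n)
      simp only [NNReal.coe_zero]
      rw [← h0]
      linarith
    · have hu' : (u : ℝ) ≤ L (N + φ n) - s (φ n) := hu
      have hv' : (v : ℝ) ≤ L (N + φ n) - s (φ n) := hv
      have hu0 : (0 : ℝ) ≤ u := u.2
      have hv0 : (0 : ℝ) ≤ v := v.2
      have hn0 : (0 : ℝ) ≤ φ n := Nat.cast_nonneg _
      exact hcgeo (φ n) _ ⟨by linarith, by linarith⟩ _ ⟨by linarith, by linarith⟩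
    · have hn0 : (0 : ℝ) ≤ φ n := Nat.cast_nonneg _
      change c (φ n) (L (N + φ n) - s (φ n)) = _
      rw [hcg _ _ ⟨by linarith, le_rfl⟩, add_sub_cancel, hg1]
    · rw [← NNReal.coe_le_coe]
      push_cast
      have : (0 : ℝ) ≤ N := Nat.cast_nonneg _
      linarith

end Hyperbolic

/-! ## Extensions of the identity of a hyperbolic space -/

section Extension

open scoped ENNReal

variable {X Y : Type*} [MetricSpace X] [MetricSpace Y] {ι : X → Y} {δ : ℝ}
  {Φ : GromovCompactification (dist : X → X → ℝ) → Y}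

/-- A continuous extension maps the class of a ray to the limit of the ray. -/
theorem tendsto_ray_of_continuous (hΦc : Continuous Φ) (hΦ : ∀ x, Φ (.of x) = ι x)
    (γ : GeodesicRay (dist : X → X → ℝ)) :
    Tendsto (fun t => ι (γ.1 t)) atTop (𝓝 (Φ (.bdry (Quot.mk _ γ)))) := by
  refine tendsto_of_seq_tendsto fun t ht => ?_
  -- The truncations of `γ` at `t n` converge to `γ`, so `γ (t n)` tends to the class of `γ` in the
  -- Gromov compactification.
  have hγt : ∀ n, IsStoppedGeodesic (t n) (fun s => γ.1 (min s (t n))) := fun n =>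
    isStoppedGeodesic_coe (fun s hs u hu => by rw [min_eq_left hs, min_eq_left hu, γ.2])
      fun s hs => by rw [min_eq_right hs, min_self]
  have hconv : ConvergesLocallyUniformly dist (fun n s => γ.1 (min s (t n))) γ.1 := by
    intro R ε hε
    obtain ⟨N, hN⟩ := eventually_atTop.1 (ht.eventually_ge_atTop R)
    refine ⟨N, fun n hn s hs => ?_⟩
    simp only [min_eq_left (hs.trans (hN n hn)), dist_self]
    exact hε
  have := hconv.gromovConverges (o := γ.1 0) (ξ := .bdry (Quot.mk _ γ))
    (fun n => (hγt n).isGeneralizedRay_coe (by simp)) ⟨rfl, γ, rfl, rfl⟩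
  refine ((hΦc.tendsto _).comp this.tendsto).congr fun n => ?_
  simp [hΦ]

/-- A continuous extension of the identity to the Gromov compactification of a hyperbolic space
forces visibility. -/
theorem IsSlim.isVisibilityCompactification [ProperSpace X] (h : IsSlim X δ)
    (hX : IsGeodesicSpace X) (hι : IsEmbedding ι) (hd : DenseRange ι) (hΦc : Continuous Φ)
    (hΦ : ∀ x, Φ (.of x) = ι x) : IsVisibilityCompactification ι := by
  intro p hp q hq hpq
  by_contra! hcon
  obtain ⟨o⟩ : Nonempty X := hd.nonempty_iff.2 ⟨p⟩
  -- Failure of visibility for balls of radius `1 / (n + 1)` about `p` and `q`, and for the compact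
  -- ball of radius `n` about `o`.
  have hcon' : ∀ n : ℕ, ∃ x y B, dist (ι x) p < 1 / ((n : ℝ) + 1) ∧
      dist (ι y) q < 1 / ((n : ℝ) + 1) ∧ IsGeodesicSegment dist x y B ∧
      ∀ z ∈ B, (n : ℝ) ≤ dist o z := fun n => by
    have hn : 0 < 1 / ((n : ℝ) + 1) := by positivity
    obtain ⟨a, b, γ, hab, hγ, hU, hV, he⟩ := hcon _ (Metric.ball_mem_nhds p hn) _
      (Metric.ball_mem_nhds q hn) _ (isCompact_closedBall o n)
    refine ⟨_, _, _, hU, hV, isGeodesicSegment_of_isGeodesicOn hab hγ, fun z hz => ?_⟩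
    by_contra! hlt
    exact he.subset ⟨hz, Metric.mem_closedBall'.2 hlt.le⟩
  choose x y B hx hy hB hBn using hcon'
  have hxp : Tendsto (fun n => ι (x n)) atTop (𝓝 p) := tendsto_iff_dist_tendsto_zero.2
    (squeeze_zero (fun _ => dist_nonneg) (fun n => (hx n).le)
      tendsto_one_div_add_atTop_nhds_zero_nat)
  have hyq : Tendsto (fun n => ι (y n)) atTop (𝓝 q) := tendsto_iff_dist_tendsto_zero.2
    (squeeze_zero (fun _ => dist_nonneg) (fun n => (hy n).le)
      tendsto_one_div_add_atTop_nhds_zero_nat)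
  have hxo : Tendsto (fun n => nndist o (x n)) atTop atTop := NNReal.tendsto_coe_atTop.1
    (tendsto_dist_atTop_of_notMem_range hι.continuous hxp hp o)
  have hyo : Tendsto (fun n => nndist o (y n)) atTop atTop := NNReal.tendsto_coe_atTop.1
    (tendsto_dist_atTop_of_notMem_range hι.continuous hyq hq o)
  choose c hc hc0 hc1 using fun n => hX.exists_isStoppedGeodesic o (x n)
  choose e he he0 he1 using fun n => hX.exists_isStoppedGeodesic o (y n)
  obtain ⟨φ, hφ, R, c', hR, hc', hc'0, hcc'⟩ := exists_subseq_isStoppedGeodesic hc hc0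
  obtain ⟨ψ, hψ, R', e', hR', he', he'0, hee'⟩ := exists_subseq_isStoppedGeodesic
    (fun n => he (φ n)) fun n => he0 (φ n)
  have hφψ : Tendsto (fun n => φ (ψ n)) atTop atTop := hφ.tendsto_atTop.comp hψ.tendsto_atTop
  obtain rfl : R = ⊤ := tendsto_nhds_unique hR
    ((ENNReal.tendsto_coe_nhds_top.2 hxo).comp hφ.tendsto_atTop)
  obtain rfl : R' = ⊤ := tendsto_nhds_unique hR' ((ENNReal.tendsto_coe_nhds_top.2 hyo).comp hφψ)
  have h1 : Φ (.bdry (Quot.mk _ hc'.ray)) = p := by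
    have := (hcc'.gromovConverges (fun n => (hc _).isGeneralizedRay_coe (hc0 _))
      (hc'.isGeneralizedRay_top hc'0)).tendsto
    refine tendsto_nhds_unique ((hΦc.tendsto _).comp this) ?_
    refine (hxp.comp hφ.tendsto_atTop).congr fun n => ?_
    simp [hΦ, hc1]
  have h2 : Φ (.bdry (Quot.mk _ he'.ray)) = q := by
    have := (hee'.gromovConverges (fun n => (he _).isGeneralizedRay_coe (he0 _))
      (he'.isGeneralizedRay_top he'0)).tendsto
    refine tendsto_nhds_unique ((hΦc.tendsto _).comp this) ?_
    refine (hyq.comp hφψ).congr fun n => ?_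
    simp [hΦ, he1]
  refine hpq ?_
  rw [← h1, ← h2, GeodesicRay.mk_eq_mk_iff.2]
  -- The third side is at distance at least `φ (ψ n)` from `o`, so the two segments are `2δ`-close
  -- at time `t` as soon as this exceeds `t + δ`.
  refine ⟨2 * δ, fun t => ?_⟩
  refine le_of_tendsto (((hcc'.tendsto t).comp hψ.tendsto_atTop).dist (hee'.tendsto t)) ?_
  filter_upwards [(hxo.comp hφψ).eventually_ge_atTop t, (hyo.comp hφψ).eventually_ge_atTop t,
    ((tendsto_natCast_atTop_atTop (R := ℝ)).comp hφψ).eventually_ge_atTop (t + δ)] with n e1 e2 e3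
  refine h.dist_le_of_forall_le_dist
    (fun s hs t ht => (hc _).dist_eq (by exact_mod_cast hs) (by exact_mod_cast ht))
    (fun s hs t ht => (he _).dist_eq (by exact_mod_cast hs) (by exact_mod_cast ht))
    (by rw [hc0, he0]) (B := B (φ (ψ n))) (N := φ (ψ n)) ?_ ?_ e1 e2 e3
  · simpa only [Function.comp, hc1, he1] using hB _
  · rw [hc0]
    exact hBn _

/-- The two ends of a geodesic line. -/
def lineRay {g : ℝ → X} (hg : IsGeodesicOn dist univ g) : GeodesicRay (dist : X → X → ℝ) :=
  ⟨fun t => g t, fun _ _ => hg _ trivial _ trivial⟩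

theorem IsGeodesicOn.comp_neg {g : ℝ → X} (hg : IsGeodesicOn dist univ g) :
    IsGeodesicOn dist univ fun t => g (-t) := fun s _ t _ => by
  rw [hg _ trivial _ trivial, neg_sub_neg, abs_sub_comm]

theorem setOf_mapClusterPt_eq_singleton {α : Type*} {l : Filter α} [l.NeBot] {u : α → Y} {y : Y}
    (h : Tendsto u l (𝓝 y)) : {p | MapClusterPt p l u} = {y} := by
  ext p
  refine ⟨fun hp => ?_, fun hp => ?_⟩
  · obtain ⟨U, hU, hp⟩ := mapClusterPt_iff_ultrafilter.1 hp
    exact tendsto_nhds_unique hp (h.mono_left hU)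
  · obtain rfl := hp
    exact h.mapClusterPt

/-- A geodesic line is a loop if and only if a continuous extension identifies its ends. -/
theorem isGeodesicLoop_iff (hΦc : Continuous Φ) (hΦ : ∀ x, Φ (.of x) = ι x) {g : ℝ → X}
    (hg : IsGeodesicOn dist univ g) : IsGeodesicLoop dist ι g ↔
      Φ (.bdry (Quot.mk _ (lineRay hg))) = Φ (.bdry (Quot.mk _ (lineRay hg.comp_neg))) := by
  have key : ∀ {f : ℝ → X} (hf : IsGeodesicOn dist univ f),
      Tendsto (ι ∘ f) atTop (𝓝 (Φ (.bdry (Quot.mk _ (lineRay hf))))) := fun {f} hf => by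
    refine ((tendsto_ray_of_continuous hΦc hΦ (lineRay hf)).comp
      tendsto_real_toNNReal_atTop).congr' ?_
    filter_upwards [eventually_ge_atTop 0] with t ht
    simp [lineRay, Real.coe_toNNReal t ht]
  have h2 : Tendsto (ι ∘ g) atBot (𝓝 (Φ (.bdry (Quot.mk _ (lineRay hg.comp_neg))))) := by
    refine ((key hg.comp_neg).comp tendsto_neg_atBot_atTop).congr fun t => ?_
    simp
  rw [IsGeodesicLoop, setOf_mapClusterPt_eq_singleton (key hg), setOf_mapClusterPt_eq_singleton h2,
    singleton_eq_singleton_iff]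
  exact and_iff_right hg

/-- `g t` and `g (-t)` are `2t` apart, which exceeds `C` at `t = |C| + 1`. -/
theorem not_asymptotic_lineRay {g : ℝ → X} (hg : IsGeodesicOn dist univ g) :
    ¬ (lineRay hg).Asymptotic (lineRay hg.comp_neg) := by
  rintro ⟨C, hC⟩
  have h := hC (|C| + 1).toNNReal
  have h0 : 0 ≤ |C| := abs_nonneg C
  simp only [lineRay, Real.coe_toNNReal _ (by linarith : 0 ≤ |C| + 1)] at h
  rw [hg _ trivial _ trivial, abs_of_nonneg (by linarith)] at h
  linarith [le_abs_self C]

theorem IsSlim.injective_of_not_loop [ProperSpace X] (h : IsSlim X δ) (hX : IsGeodesicSpace X)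
    (hι : IsEmbedding ι) (hΦc : Continuous Φ) (hΦ : ∀ x, Φ (.of x) = ι x)
    (hloop : ¬ ∃ g : ℝ → X, IsGeodesicLoop dist ι g) : Function.Injective Φ := by
  have hbdry : ∀ σ x, Φ (.bdry σ) ≠ ι x := fun σ x hx => by
    obtain ⟨γ, rfl⟩ := Quot.exists_rep σ
    exact notMem_range_of_tendsto_dist_atTop hι (tendsto_ray_of_continuous hΦc hΦ γ)
      γ.isStoppedGeodesic.tendsto_dist ⟨x, hx.symm⟩
  rintro (x | σ) (y | τ) heq
  · rw [hΦ, hΦ] at heq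
    rw [hι.injective heq]
  · exact absurd (heq.symm.trans (hΦ x)) (hbdry τ x)
  · exact absurd (heq.trans (hΦ y)) (hbdry σ y)
  · obtain ⟨o⟩ : Nonempty X := by
      obtain ⟨γ, -⟩ := Quot.exists_rep σ
      exact ⟨γ.1 0⟩
    -- Both classes are represented by rays from the same base point, as `exists_line` requires.
    obtain ⟨c, hc0, γ, rfl, rfl⟩ := h.exists_isGeneralizedRay hX o (.bdry σ)
    obtain ⟨e, he0, η, rfl, rfl⟩ := h.exists_isGeneralizedRay hX o (.bdry τ)
    by_contra hne
    have hne' : ¬ γ.Asymptotic η := fun h => hne (by rw [GeodesicRay.mk_eq_mk_iff.2 h])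
    obtain ⟨g, hg, C, hC⟩ := h.exists_line hX (hc0.trans he0.symm) hne'
    refine hloop ⟨g, (isGeodesicLoop_iff hΦc hΦ hg).2 ?_⟩
    have h1 : (lineRay hg).Asymptotic η := ⟨C, fun t => (hC t).2⟩
    have h2 : (lineRay hg.comp_neg).Asymptotic γ := ⟨C, fun t => (hC t).1⟩
    rw [GeodesicRay.mk_eq_mk_iff.2 h1, GeodesicRay.mk_eq_mk_iff.2 h2]
    exact heq.symm

/-- Sequential compactness of the Gromov compactification: generalized rays from a fixed point to
the `u n` subconverge, and the end of the limit is a limit of a subsequence of `u`. -/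
theorem IsSlim.isClosedMap [ProperSpace X] (h : IsSlim X δ) (hX : IsGeodesicSpace X)
    (hΦc : Continuous Φ) : IsClosedMap Φ := by
  refine fun B hB => IsSeqClosed.isClosed fun y q hy hyq => ?_
  choose u hu huy using hy
  obtain ⟨o⟩ : Nonempty X := by
    cases u 0 with
    | of x => exact ⟨x⟩
    | bdry σ =>
      obtain ⟨γ, -⟩ := Quot.exists_rep σ
      exact ⟨γ.1 0⟩
  choose c hc using fun n => h.exists_isGeneralizedRay hX o (u n)
  choose R hR using fun n => (hc n).exists_isStoppedGeodesic
  obtain ⟨φ, hφ, R', c', -, hc', hc'0, hconv⟩ :=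
    exists_subseq_isStoppedGeodesic hR fun n => (hc n).cases.1
  obtain ⟨ξ, hξ⟩ := hc'.exists_isGeneralizedRay hc'0
  have hlim := (hconv.gromovConverges (fun n => hc (φ n)) hξ).tendsto
  refine ⟨ξ, hB.mem_of_tendsto hlim (Eventually.of_forall fun n => hu _), ?_⟩
  refine tendsto_nhds_unique ((hΦc.tendsto _).comp hlim) ?_
  refine (hyq.comp hφ.tendsto_atTop).congr fun n => (huy _).symm

theorem isHomeomorph_iff_not_loop [ProperSpace X] (h : IsSlim X δ) (hX : IsGeodesicSpace X)
    (hι : IsEmbedding ι) (hΦc : Continuous Φ) (hΦs : Function.Surjective Φ)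
    (hΦ : ∀ x, Φ (.of x) = ι x) :
    IsHomeomorph Φ ↔ ¬ ∃ g : ℝ → X, IsGeodesicLoop dist ι g := by
  refine ⟨fun hΦh ⟨g, hg⟩ => ?_, fun hloop => ?_⟩
  · have := hΦh.injective ((isGeodesicLoop_iff hΦc hΦ hg.1).1 hg)
    injection this with this
    exact not_asymptotic_lineRay hg.1 (GeodesicRay.mk_eq_mk_iff.1 this)
  · exact isHomeomorph_iff_continuous_isClosedMap_bijective.2
      ⟨hΦc, h.isClosedMap hX hΦc, h.injective_of_not_loop hX hι hΦc hΦ hloop, hΦs⟩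

/-- Visibility and extension of the identity for a complete locally compact geodesic Gromov
hyperbolic space in a metrizable compactification. -/
theorem isVisibilityCompactification_iff [LocallyCompactSpace X] [CompactSpace Y] {ρ : X → X → ℝ}
    (hρ : ρ = dist) (hc : IsCauchyCompleteDist ρ) (hG : IsGromovHyperbolic ρ)
    (hX : ∀ x y, ∃ γ : ℝ → X, IsGeodesicOn ρ (Icc 0 (ρ x y)) γ ∧ γ 0 = x ∧ γ (ρ x y) = y)
    (hι : IsEmbedding ι) (hd : DenseRange ι) :
    (IsVisibilityCompactification ι ↔ ∃ Φ : GromovCompactification ρ → Y,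
      Continuous Φ ∧ Function.Surjective Φ ∧ ∀ x, Φ (.of x) = ι x) ∧
    ∀ Φ : GromovCompactification ρ → Y,
      (Continuous Φ ∧ Function.Surjective Φ ∧ ∀ x, Φ (.of x) = ι x) →
      (IsHomeomorph Φ ↔ ¬ ∃ γ : ℝ → X, IsGeodesicLoop ρ ι γ) := by
  subst hρ
  have : CompleteSpace X := Metric.complete_of_cauchySeq_tendsto fun u hu => by
    obtain ⟨x, hx⟩ := hc u (Metric.cauchySeq_iff.1 hu)
    exact ⟨x, tendsto_iff_dist_tendsto_zero.2 hx⟩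
  have hX : IsGeodesicSpace X := hX
  have := hX.properSpace
  obtain ⟨δ, -, hδ⟩ := hG
  have h : IsSlim X δ := hδ
  exact ⟨⟨fun hV => hV.exists_extension hι hd hX,
    fun ⟨Φ, hΦc, _, hΦ⟩ => h.isVisibilityCompactification hX hι hd hΦc hΦ⟩,
    fun Φ ⟨hΦc, hΦs, hΦ⟩ => isHomeomorph_iff_not_loop h hX hι hΦc hΦs hΦ⟩

end Extension

/-! ## Geodesic subspaces of submanifolds -/

section Submanifold

variable {d : ℕ} {M S : Set (EuclideanSpace ℂ (Fin d))}

theorem IsEmbeddedComplexSubmanifold.exists_dist_le_mul_kobayashiDist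
    (hM : IsEmbeddedComplexSubmanifold M) (hMc : IsConnected M) (hMb : Bornology.IsBounded M) :
    ∃ C > 0, ∀ z ∈ M, ∀ w ∈ M, dist z w ≤ C * kobayashiDist M z w := by
  obtain ⟨R, hR⟩ := hMb.subset_closedBall 0
  refine ⟨4 * (|R| + 1), by positivity, fun z hz w hw => ?_⟩
  refine dist_le_mul_kobayashiDist (hR.trans (Metric.closedBall_subset_closedBall ?_))
    (by positivity) (hM.chainLengths_nonempty hMc hz hw)
  linarith [le_abs_self R]

/-- The Kobayashi distance as a metric on a subset of a bounded connected submanifold, without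
regard to the Euclidean topology. -/
noncomputable abbrev kobayashiMetricSpaceAux
    (hM : IsEmbeddedComplexSubmanifold M) (hMc : IsConnected M)
    (hMb : Bornology.IsBounded M) (hS : S ⊆ M) : MetricSpace S where
  dist := kobayashiDistOn M S
  dist_self _ := kobayashiDist_self
  dist_comm _ _ := kobayashiDist_comm
  dist_triangle x y z := kobayashiDist_triangle (hM.chainLengths_nonempty hMc (hS x.2) (hS y.2))
    (hM.chainLengths_nonempty hMc (hS y.2) (hS z.2))
  eq_of_dist_eq_zero {x y} h := by
    obtain ⟨C, -, hC⟩ := hM.exists_dist_le_mul_kobayashiDist hMc hMb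
    have h1 := hC x (hS x.2) y (hS y.2)
    have h2 : kobayashiDist M x y = 0 := h
    rw [h2, mul_zero] at h1
    exact Subtype.ext (dist_le_zero.1 h1)

/-- Small discs put a Euclidean neighbourhood inside each Kobayashi ball; the Schwarz estimate gives
the other inclusion. -/
theorem topology_eq_kobayashiMetricSpaceAux (hM : IsEmbeddedComplexSubmanifold M)
    (hMc : IsConnected M) (hMb : Bornology.IsBounded M) (hS : S ⊆ M) :
    (instTopologicalSpaceSubtype : TopologicalSpace S) =
      (kobayashiMetricSpaceAux hM hMc hMb hS).toUniformSpace.toTopologicalSpace := by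
  obtain ⟨C, hC0, hC⟩ := hM.exists_dist_le_mul_kobayashiDist hMc hMb
  refine TopologicalSpace.ext_nhds fun x => ?_
  have b1 := Metric.nhds_basis_ball (x := x)
  have b2 := @Metric.nhds_basis_ball _
    (kobayashiMetricSpaceAux hM hMc hMb hS).toPseudoMetricSpace x
  refine le_antisymm (b2.ge_iff.2 fun ε hε => ?_) (b1.ge_iff.2 fun ε hε => ?_)
  · have h1 := hM.eventually_kobayashiDist_lt (hS x.2) hε
    have h2 : ∀ᶠ w in 𝓝[S] (x : EuclideanSpace ℂ (Fin d)), kobayashiDist M x w < ε :=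
      nhdsWithin_mono _ hS h1
    rw [← map_nhds_subtype_val x, eventually_map] at h2
    filter_upwards [h2] with y hy
    exact (kobayashiDist_comm (M := M)).trans_lt hy
  · refine b2.mem_of_superset (i := ε / C) (div_pos hε hC0) fun y hy => ?_
    have h1 : kobayashiDist M y x < ε / C := hy
    refine (hC y (hS y.2) x (hS x.2)).trans_lt ?_
    rwa [lt_div_iff₀' hC0] at h1

/-- The Kobayashi distance as a metric that induces the Euclidean topology. -/
noncomputable abbrev kobayashiMetricSpace
    (hM : IsEmbeddedComplexSubmanifold M) (hMc : IsConnected M)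
    (hMb : Bornology.IsBounded M) (hS : S ⊆ M) : MetricSpace S :=
  (kobayashiMetricSpaceAux hM hMc hMb hS).replaceTopology
    (topology_eq_kobayashiMetricSpaceAux hM hMc hMb hS)

theorem dist_kobayashiMetricSpace (hM : IsEmbeddedComplexSubmanifold M) (hMc : IsConnected M)
    (hMb : Bornology.IsBounded M) (hS : S ⊆ M) :
    kobayashiDistOn M S = (kobayashiMetricSpace hM hMc hMb hS).dist := rfl

/-- A geodesic subspace is locally compact. -/
theorem IsGeodesicSubspace.locallyCompactSpace (hS : IsGeodesicSubspace M S)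
    (hM : IsEmbeddedComplexSubmanifold M) (hMc : IsConnected M) (hMb : Bornology.IsBounded M) :
    LocallyCompactSpace S := by
  obtain ⟨C, hC0, hC⟩ := hM.exists_dist_le_mul_kobayashiDist hMc hMb
  -- A sequence in `S` with Euclidean limit in `M` is `k_M`-Cauchy. Its `k_M`-limit in `S` is also
  -- its Euclidean limit.
  have key : S = M ∩ closure S := by
    refine Subset.antisymm (subset_inter hS.1 subset_closure) fun x ⟨hxM, hx⟩ => ?_
    obtain ⟨u, hu, hux⟩ := mem_closure_iff_seq_limit.1 hx
    have hk : ∀ ε > 0, ∀ᶠ n in atTop, kobayashiDist M x (u n) < ε := fun ε hε =>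
      (tendsto_nhdsWithin_iff.2 ⟨hux, Eventually.of_forall fun n => hS.1 (hu n)⟩).eventually
        (hM.eventually_kobayashiDist_lt hxM hε)
    obtain ⟨y, hy⟩ := hS.2.1 (fun n => ⟨u n, hu n⟩) fun ε hε => by
      obtain ⟨N, hN⟩ := eventually_atTop.1 (hk (ε / 2) (half_pos hε))
      refine ⟨N, fun m hm n hn => ?_⟩
      have h1 := kobayashiDist_triangle (hM.chainLengths_nonempty hMc (hS.1 (hu m)) hxM)
        (hM.chainLengths_nonempty hMc hxM (hS.1 (hu n)))
      have h2 := hN m hm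
      rw [kobayashiDist_comm] at h2
      have h3 := hN n hn
      change kobayashiDist M (u m) (u n) < ε
      linarith
    have hy' : Tendsto u atTop (𝓝 (y : EuclideanSpace ℂ (Fin d))) := by
      refine tendsto_iff_dist_tendsto_zero.2 (squeeze_zero (fun _ => dist_nonneg)
        (fun n => hC _ (hS.1 (hu n)) _ (hS.1 y.2)) ?_)
      have := hy.const_mul C
      rwa [mul_zero] at this
    rw [tendsto_nhds_unique hux hy']
    exact y.2
  have : IsLocallyClosed S := by
    rw [key]
    exact hM.isLocallyClosed.inter isClosed_closure.isLocallyClosed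
  exact this.locallyCompactSpace

/-- Points of a geodesic subspace are joined by geodesic segments in the subspace. -/
theorem IsGeodesicSubspace.exists_geodesic (hS : IsGeodesicSubspace M S) (x y : S) :
    ∃ γ : ℝ → S, IsGeodesicOn (kobayashiDistOn M S) (Icc 0 (kobayashiDistOn M S x y)) γ ∧
      γ 0 = x ∧ γ (kobayashiDistOn M S x y) = y := by
  rcases eq_or_ne x y with rfl | hxy
  · have h0 : kobayashiDistOn M S x x = 0 := kobayashiDist_self
    refine ⟨fun _ => x, fun s hs t ht => ?_, rfl, rfl⟩
    rw [h0, Icc_self, mem_singleton_iff] at hs ht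
    rw [h0, hs, ht]
    simp
  obtain ⟨I, γ, hI, hγ, hγS, ⟨a, ha, hax⟩, b, hb, hby⟩ :=
    hS.2.2 x x.2 y y.2 (Subtype.coe_ne_coe.2 hxy)
  have hab : kobayashiDistOn M S x y = |a - b| := by
    change kobayashiDist M x y = _
    rw [← hax, ← hby, hγ a ha b hb]
  have hL := abs_nonneg (a - b)
  -- `θ = ±1` reverses the geodesic when it meets `y` before `x`.
  obtain ⟨θ, hθ, hθb⟩ : ∃ θ : ℝ, |θ| = 1 ∧ a + θ * |a - b| = b := by
    rcases le_total a b with h | h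
    · exact ⟨1, by simp, by rw [abs_of_nonpos (by linarith)]; ring⟩
    · exact ⟨-1, by simp, by rw [abs_of_nonneg (by linarith)]; ring⟩
  have hmem : ∀ t ∈ Icc 0 |a - b|, a + θ * t ∈ I := fun t ht => by
    refine (hI.uIcc_subset ha hb) ?_
    rw [mem_uIcc]
    rcases (abs_eq one_pos.le).1 hθ with rfl | rfl
    · exact .inl ⟨by linarith [ht.1], by linarith [ht.2]⟩
    · exact .inr ⟨by linarith [ht.2], by linarith [ht.1]⟩
  rw [hab]
  -- Off `I` the values of `γ` may leave `S`; `projIcc` yields a map into `S` on all of `ℝ`.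
  refine ⟨fun t => ⟨γ (a + θ * projIcc 0 |a - b| hL t), hγS (hmem _ (Subtype.coe_prop _))⟩,
    fun s hs t ht => ?_, Subtype.ext ?_, Subtype.ext ?_⟩
  · change kobayashiDist M (γ _) (γ _) = _
    rw [projIcc_of_mem hL hs, projIcc_of_mem hL ht, hγ _ (hmem s hs) _ (hmem t ht)]
    rw [add_sub_add_left_eq_sub, ← mul_sub, abs_mul, hθ, one_mul]
  · simpa using hax
  · simpa [hθb] using hby

theorem notMem_range_inclusion_iff {p : closure S} :
    p ∉ range (inclusion (subset_closure (s := S))) ↔ (p : EuclideanSpace ℂ (Fin d)) ∉ S := by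
  rw [range_inclusion]
  rfl

/-- Visibility subspaces in terms of the Kobayashi metric. -/
theorem IsGeodesicSubspace.isVisibilitySubspace_iff (hS : IsGeodesicSubspace M S)
    (m : MetricSpace S) (hm : kobayashiDistOn M S = m.dist)
    (hmt : m.toUniformSpace.toTopologicalSpace = instTopologicalSpaceSubtype) :
    IsVisibilitySubspace M S ↔
      @IsVisibilityCompactification S (closure S) m _ (inclusion subset_closure) := by
  rw [IsVisibilitySubspace, and_iff_right hS]
  constructor
  · intro h p hp q hq hpq
    obtain ⟨U, hU, V, hV, K, hKS, hK, -, hUVK⟩ := h p ⟨p.2, notMem_range_inclusion_iff.1 hp⟩ q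
      ⟨q.2, notMem_range_inclusion_iff.1 hq⟩ (Subtype.coe_ne_coe.2 hpq)
    refine ⟨_, continuousAt_subtype_val hU, _, continuousAt_subtype_val hV, Subtype.val ⁻¹' K, ?_,
      fun a b γ hab hγ ha hb => ?_⟩
    · rw [hmt]
      exact Topology.IsInducing.subtypeVal.isCompact_preimage_iff (by simpa using hKS) |>.2 hK
    · obtain ⟨_, ⟨t, ht, rfl⟩, hz⟩ := hUVK a b (fun t => γ t) hab (fun t _ => (γ t).2)
        (fun s hs t ht => by
          rw [← hγ s hs t ht]
          exact congrFun (congrFun hm (γ s)) (γ t)) ha hb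
      exact ⟨γ t, ⟨t, ht, rfl⟩, hz⟩
  · intro h p hp q hq hpq
    obtain ⟨U, hU, V, hV, K, hK, hUVK⟩ := h ⟨p, hp.1⟩ (notMem_range_inclusion_iff.2 hp.2) ⟨q, hq.1⟩
      (notMem_range_inclusion_iff.2 hq.2) (fun he => hpq (congrArg Subtype.val he))
    obtain ⟨U', hU', hUU'⟩ := mem_nhds_subtype _ _ _ |>.1 hU
    obtain ⟨V', hV', hVV'⟩ := mem_nhds_subtype _ _ _ |>.1 hV
    have hr : 0 < dist p q / 3 := by
      have := dist_pos.2 hpq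
      positivity
    -- Balls of a third of the distance provide the disjoint closures demanded of a visibility
    -- subspace.
    refine ⟨U' ∩ Metric.closedBall p (dist p q / 3),
      inter_mem hU' (Metric.closedBall_mem_nhds p hr), V' ∩ Metric.closedBall q (dist p q / 3),
      inter_mem hV' (Metric.closedBall_mem_nhds q hr), Subtype.val '' K,
      by simp, ?_, ?_, fun a b γ hab hγS hγ ha hb => ?_⟩
    · rw [hmt] at hK
      exact hK.image continuous_subtype_val
    · refine Disjoint.mono (closure_minimal inter_subset_right Metric.isClosed_closedBall)
        (closure_minimal inter_subset_right Metric.isClosed_closedBall)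
        (Metric.closedBall_disjoint_closedBall ?_)
      linarith
    · obtain ⟨z, ⟨t, ht, rfl⟩, hz⟩ := hUVK a b
        (fun t => ⟨γ (projIcc a b hab t), hγS (Subtype.coe_prop _)⟩) hab (fun s hs t ht => by
          rw [← hγ s hs t ht]
          refine (congrFun (congrFun hm _) _).symm.trans ?_
          change kobayashiDist M (γ _) (γ _) = _
          rw [projIcc_of_mem hab hs, projIcc_of_mem hab ht])
        (hUU' (by simpa [inclusion] using ha.1)) (hVV' (by simpa [inclusion] using hb.1))
      refine ⟨γ t, ⟨t, ht, rfl⟩, _, hz, ?_⟩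
      change γ (projIcc a b hab t) = γ t
      rw [projIcc_of_mem hab ht]

theorem denseRange_inclusion_closure : DenseRange (inclusion (subset_closure (s := S))) :=
  fun x => by
    rw [range_inclusion, closure_subtype]
    have : Subtype.val '' {x : closure S | (x : EuclideanSpace ℂ (Fin d)) ∈ S} = S :=
      Subtype.image_preimage_coe _ _ |>.trans (inter_eq_right.2 subset_closure)
    rw [this]
    exact x.2

end Submanifold

theorem mainTheorem1 (d : ℕ) (M S : Set (EuclideanSpace ℂ (Fin d)))
    (hM : IsEmbeddedComplexSubmanifold M) (hMconn : IsConnected M)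
    (hMbdd : Bornology.IsBounded M) (hS : IsGeodesicSubspace M S)
    (hG : IsGromovHyperbolic (kobayashiDistOn M S)) :
    (IsVisibilitySubspace M S ↔
      ∃ Φ : GromovCompactification (kobayashiDistOn M S) → closure S,
        IsContinuousSurjectiveExtension M S Φ) ∧
    ∀ Φ : GromovCompactification (kobayashiDistOn M S) → closure S,
      IsContinuousSurjectiveExtension M S Φ →
      (IsHomeomorph Φ ↔
        ¬ ∃ γ : ℝ → S, IsGeodesicLoop (kobayashiDistOn M S) (inclusion subset_closure) γ) := by
  have hcomp : CompactSpace (closure S) :=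
    isCompact_iff_compactSpace.1 (hMbdd.subset hS.1).isCompact_closure
  have hι : IsEmbedding (inclusion (subset_closure (s := S))) := IsEmbedding.inclusion _
  have hm := dist_kobayashiMetricSpace hM hMconn hMbdd hS.1
  -- `rfl` suffices because the metric was built with the subspace topology as its underlying
  -- topology.
  rw [hS.isVisibilitySubspace_iff (kobayashiMetricSpace hM hMconn hMbdd hS.1) hm rfl]
  exact @isVisibilityCompactification_iff S (closure S) (kobayashiMetricSpace hM hMconn hMbdd hS.1)
    _ _ (hS.locallyCompactSpace hM hMconn hMbdd) hcomp _ hm hS.2.1 hG hS.exists_geodesic hι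
    denseRange_inclusion_closure
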